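/- Let $C\subset\mathbb{R}^3$ be the regular octahedron of unit edge centred at the origin, i.e. the convex hull of the six points $\pm\frac{1}{\sqrt2}e_1,\pm\frac{1}{\sqrt2}e_2,\pm\frac{1}{\sqrt2}e_3$. For a unit vector $U=(x,y,z)$ let $cw(U)$ (the chorowidth) be the area and $pw(U)$ (the periwidth) the circumference of the convex polygon obtained by projecting $C$ orthogonally onto the plane $U^{\perp}$. Here $\operatorname{arcsec}(t)=\arccos(1/t)$ and $\operatorname{arccot}(t)=\frac{\pi}{2}-\arctan t$. (a) If $U$ is uniformly distributed on the unit sphere, then $cw$, $cw^2$ and $pw$ are integrable and \[ \mathbb{E}(cw)=\frac{\sqrt3}{2}=\frac{\text{surface area of }C}{4},\qquad \mathbb{E}(cw^2)=\frac12+\frac{\sqrt2}{\pi}-\frac{1}{2\pi}\operatorname{arcsec}(3),\qquad \mathbb{E}(pw)=3\operatorname{arcsec}(3), \] \[ \mathbb{P}(\text{projection has 4 vertices})=\frac{3}{\pi}\bigl(\pi-2\operatorname{arcsec}(3)\bigr),\qquad \mathbb{P}(\text{projection has 6 vertices})=\frac{2}{\pi}\bigl(3\operatorname{arcsec}(3)-\pi\bigr).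 \] (b) Let $\delta=\operatorname{arccot}(\sqrt2)$, and for $0\le\varphi\le\frac{\pi}{2}$ let $\alpha(\varphi)=\frac{\pi}{4}-\operatorname{arcsec}(\sqrt2\tan\varphi)$ if $\delta\le\varphi\le\frac{\pi}{2}$ (with $\operatorname{arcsec}(\infty)=\frac{\pi}{2}$, so that $\alpha(\frac{\pi}{2})=-\frac{\pi}{4}$), $\alpha(\varphi)=\frac{\pi}{4}$ if $0\le\varphi\le\delta$, and $\beta(\varphi)=-\alpha(\varphi)$. Let $U=(x,y,z)=(\cos\theta\sin\varphi,\sin\theta\sin\varphi,\cos\varphi)$ lie in the first hexadecant $0\le\theta\le\frac{\pi}{4}$, $0\le\varphi\le\frac{\pi}{2}$ (one of sixteen congruent regions of the sphere). Then at least one of the following three cases holds, and in each case that holds the stated formulas are valid. 1. If $\delta\le\varphi\le\frac{\pi}{2}$ and $\max\{\alpha(\varphi),\beta(\varphi)\}\le\theta\le\frac{\pi}{4}$, then \[ cw=\tfrac12(x+y+z),\qquad pw=\sqrt2\left(\sqrt{2-(x+y)^2}+\sqrt{2-(x+z)^2}+\sqrt{2-(y+z)^2}\right). \] 2. If $\frac{\pi}{4}\le\varphi\le\frac{\pi}{2}$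 and $0\le\theta\le\beta(\varphi)$, then \[ cw=x,\qquad pw=\sqrt2\left(\sqrt{2-(y-z)^2}+\sqrt{2-(y+z)^2}\right). \] 3. If $0\le\varphi\le\frac{\pi}{4}$ and $0\le\theta\le\alpha(\varphi)$, then \[ cw=z,\qquad pw=\sqrt2\left(\sqrt{2-(x-y)^2}+\sqrt{2-(x+y)^2}\right). \] -/

import Mathlib

open MeasureTheory

/-- Euclidean three-space. -/
abbrev E3 : Type := EuclideanSpace ℝ (Fin 3)

/-- The uniform probability distribution on the unit sphere of `E3`: surface measure divided by
its total mass. -/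
noncomputable def sphereUniform : Measure (Metric.sphere (0 : E3) 1) :=
  ((volume : Measure E3).toSphere Set.univ)⁻¹ • (volume : Measure E3).toSphere

instance sphereUniform_isProbabilityMeasure : IsProbabilityMeasure sphereUniform := by
  constructor
  have h0 : (volume : Measure E3).toSphere Set.univ ≠ 0 := by
    have h := (Measure.measure_univ_ne_zero (μ := (volume : Measure E3).toSphere))
    refine h.2 ?_
    intro h1
    exact Measure.toSphere_ne_zero (volume : Measure E3) h1
  have h1 : (volume : Measure E3).toSphere Set.univ ≠ ⊤ := measure_ne_top _ _
  simp only [sphereUniform, Measure.smul_apply, smul_eq_mul]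
  exact ENNReal.inv_mul_cancel h0 h1

/-- The six vertices `± e_i / √2` of the regular octahedron of edge length one. -/
noncomputable def octahedronVertices : Set E3 :=
  {v | ∃ i : Fin 3, v = EuclideanSpace.single i (1 / √2) ∨ v = EuclideanSpace.single i (-(1 / √2))}

/-- The regular octahedron of edge length one, centred at the origin. -/
noncomputable def octahedron : Set E3 := convexHull ℝ octahedronVertices

/-- The plane of all vectors orthogonal to `u` (a plane as soon as `u ≠ 0`), with the inner
product, the metric and the Lebesgue measure that it inherits from `E3`. -/
noncomputable abbrev shadowPlane (u : E3) : Submodule ℝ E3 := (ℝ ∙ u)ᗮ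

/-- The orthogonal projection of the octahedron on the plane orthogonal to `u`, as a subset of
that plane. -/
noncomputable def octahedronShadow (u : E3) : Set (shadowPlane u) :=
  (shadowPlane u).orthogonalProjectionOnto '' octahedron

/-- Chorowidth: the area of the projection (two-dimensional Lebesgue measure in its plane). -/
noncomputable def chorowidth (u : E3) : ℝ :=
  (volume (octahedronShadow u)).toReal

/-- Periwidth: the circumference of the projection, i.e. the length (one-dimensional Hausdorff
measure) of its boundary relative to its plane. -/
noncomputable def periwidth (u : E3) : ℝ :=
  (μH[1] (frontier (octahedronShadow u))).toReal

/-- The number of vertices (extreme points) of the projection. -/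
noncomputable def shadowVertexCount (u : E3) : ℕ :=
  (Set.extremePoints ℝ (octahedronShadow u)).ncard

/-- The surface area of the octahedron: the two-dimensional Hausdorff measure of its boundary,
normalized so as to agree with Lebesgue measure on planes. -/
noncomputable def octahedronSurfaceArea : ℝ :=
  (μHE[2] (frontier octahedron)).toReal

/-- The inverse secant, with values in `[0, π]`. -/
noncomputable def arcsec (t : ℝ) : ℝ := Real.arccos (1 / t)

/-- The inverse cotangent, with values in `(0, π)`. -/
noncomputable def arccot (t : ℝ) : ℝ := Real.pi / 2 - Real.arctan t

/-- The point with spherical coordinates `(θ, φ)`. -/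
noncomputable def sphericalPoint (θ φ : ℝ) : E3 :=
  !₂[Real.cos θ * Real.sin φ, Real.sin θ * Real.sin φ, Real.cos φ]

/-- The angle `δ = arccot √2 = 0.615…`. -/
noncomputable def deltaAngle : ℝ := arccot (√2)

/-- `arcsec (√2 * tan φ)` is `π / 2` at `φ = π / 2` in Lean (where `tan φ = 0` and `1 / 0 = 0`),
which is its limit from the left, the intended value there; see `alphaAngle_pi_div_two`. -/
noncomputable def alphaAngle (φ : ℝ) : ℝ :=
  if deltaAngle ≤ φ then Real.pi / 4 - arcsec (√2 * Real.tan φ) else Real.pi / 4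

/-- `β = -α`. -/
noncomputable def betaAngle (φ : ℝ) : ℝ := -alphaAngle φ

theorem alphaAngle_pi_div_two : alphaAngle (Real.pi / 2) = -(Real.pi / 4) := by
  have h : deltaAngle ≤ Real.pi / 2 := by
    have h2 : 0 ≤ Real.arctan (√2) := Real.arctan_nonneg.2 (Real.sqrt_nonneg 2)
    simp only [deltaAngle, arccot]
    linarith
  simp only [alphaAngle, if_pos h, arcsec, Real.tan_pi_div_two, mul_zero, div_zero,
    Real.arccos_zero]
  ring

/-! Up to signs and order, let `x`, `y ≤ z` be the moduli of the coordinates of `u`, and let `p`,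
`q`, `r` be the shadows of the corresponding axis vertices. Projecting `u` onto its own orthogonal
plane gives `x p + y q + z r = 0`, so the shadow is the hull of `± p`, `± q`, `± m` with `m = -r =
(x/z) p + (y/z) q`. The parallelogram spanned by `p` and `q` has area `z/2`. If `x + y ≤ z`, then
`m` adds nothing and the shadow is a parallelogram of area `z`; if `x + y > z`, it is a hexagon of
area `(1 + x/z + y/z) z/2`. The edges are differences of shadow vectors, which gives the
circumference. This is `shadow_of_add_le` and `shadow_of_lt_add`; part (b) follows by translating
the inequalities into angles, and the formulas agree on the common boundaries.

For part (a), each quantity is a sum of terms depending on `u` only through two orthonormal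
coordinates `⟨v, u⟩`, `⟨w, u⟩`, each term homogeneous of degree 0, 1 or 2. The area is a quarter of
the sum of the four `|x ± y ± z|` (Cauchy's formula). In its square, the product of two such forms
is, up to sign, `(x ± y)² - z²` or a permutation of it. An edge lies on the silhouette when its two
faces are on different sides, that is when `(x + ε y)² < z²`, so circumference and vertex count are
sums over edges.

The mean of such a term reduces to an integral over the unit circle: `integral_toSphere_plane`
evaluates a Gaussian integral once in spherical coordinates and once by splitting off the plane of
`v` and `w`. All circle integrals change regime at `cos 2t = -1/3`, which is the source of `arcsec
3`. Directions with a face seen edge-on form a null set (`ae_abs_ne`). -/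

/-! ### Areas of triangles and of centrally symmetric pairs of triangles -/

section Areas

open Module

/-- The triangle with vertices `0`, `q`, `r`. -/
def cornerTriangle {V : Type*} [AddCommGroup V] [Module ℝ V] (q r : V) : Set V :=
  {x | ∃ α β : ℝ, 0 ≤ α ∧ 0 ≤ β ∧ α + β ≤ 1 ∧ x = α • q + β • r}

/-- The union of the triangle with vertices `0`, `q`, `r` and its reflection in the origin. -/
def doubleTriangle {V : Type*} [AddCommGroup V] [Module ℝ V] (q r : V) : Set V :=
  {x | ∃ α β : ℝ, 0 ≤ α * β ∧ |α| + |β| ≤ 1 ∧ x = α • q + β • r}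

theorem volume_prod_stdTriangle :
    volume {p : ℝ × ℝ | 0 ≤ p.1 ∧ 0 ≤ p.2 ∧ p.1 + p.2 ≤ 1} = ENNReal.ofReal (1 / 2) := by
  have hm : MeasurableSet {p : ℝ × ℝ | 0 ≤ p.1 ∧ 0 ≤ p.2 ∧ p.1 + p.2 ≤ 1} :=
    (measurableSet_le measurable_const measurable_fst).inter
      ((measurableSet_le measurable_const measurable_snd).inter
        (measurableSet_le (measurable_fst.add measurable_snd) measurable_const))
  rw [Measure.volume_eq_prod, Measure.prod_apply hm]
  have h : ∀ x : ℝ, volume (Prod.mk x ⁻¹' {p : ℝ × ℝ | 0 ≤ p.1 ∧ 0 ≤ p.2 ∧ p.1 + p.2 ≤ 1}) =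
      (Set.Icc (0 : ℝ) 1).indicator (fun x => ENNReal.ofReal (1 - x)) x := by
    intro x
    by_cases hx : 0 ≤ x
    · have : Prod.mk x ⁻¹' {p : ℝ × ℝ | 0 ≤ p.1 ∧ 0 ≤ p.2 ∧ p.1 + p.2 ≤ 1} =
          Set.Icc 0 (1 - x) := by
        ext y
        simp only [Set.mem_preimage, Set.mem_ofPred_eq, Set.mem_Icc, hx, true_and]
        constructor <;> rintro ⟨h1, h2⟩ <;> exact ⟨h1, by linarith⟩
      rw [this, Real.volume_Icc, sub_zero]
      by_cases hx1 : x ≤ 1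
      · rw [Set.indicator_of_mem (Set.mem_Icc.2 ⟨hx, hx1⟩)]
      · rw [Set.indicator_of_notMem (fun h => hx1 h.2)]
        exact ENNReal.ofReal_of_nonpos (by linarith)
    · have : Prod.mk x ⁻¹' {p : ℝ × ℝ | 0 ≤ p.1 ∧ 0 ≤ p.2 ∧ p.1 + p.2 ≤ 1} = ∅ := by
        ext y
        simp [hx]
      rw [this, Set.indicator_of_notMem (fun h => hx h.1), measure_empty]
  simp_rw [h]
  rw [lintegral_indicator measurableSet_Icc,
    ← ofReal_integral_eq_lintegral_ofReal]
  · congr 1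
    rw [integral_Icc_eq_integral_Ioc, ← intervalIntegral.integral_of_le zero_le_one]
    rw [intervalIntegral.integral_sub (by simp) (by simp)]
    simp
    norm_num
  · exact (continuous_const.sub continuous_id).integrableOn_Icc
  · exact (ae_restrict_iff' measurableSet_Icc).2 (Filter.Eventually.of_forall fun x hx => by
      simpa using hx.2)

theorem volume_stdTriangle :
    volume {v : EuclideanSpace ℝ (Fin 2) | 0 ≤ v 0 ∧ 0 ≤ v 1 ∧ v 0 + v 1 ≤ 1} =
      ENNReal.ofReal (1 / 2) := by
  rw [← volume_prod_stdTriangle]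
  have h := (volume_preserving_finTwoArrow ℝ).comp
    (EuclideanSpace.volume_preserving_symm_measurableEquiv_toLp (Fin 2))
  rw [← h.measure_preimage]
  · rfl
  · refine MeasurableSet.nullMeasurableSet ?_
    exact (measurableSet_le measurable_const measurable_fst).inter
      ((measurableSet_le measurable_const measurable_snd).inter
        (measurableSet_le (measurable_fst.add measurable_snd) measurable_const))

variable {V : Type*} [NormedAddCommGroup V] [InnerProductSpace ℝ V]

/-- The triangle is the image of the standard one under the linear map sending the basis to `q`,
`r`, and the square of the area factor is the Gram determinant. The ambient dimension is left free:
the result serves both for shadows in a plane and for faces in space. -/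
theorem euclideanHausdorffMeasure_cornerTriangle [MeasurableSpace V] [BorelSpace V] (q r : V) :
    μHE[2] (cornerTriangle q r) =
      ENNReal.ofReal (1 / 2 * √(‖q‖ ^ 2 * ‖r‖ ^ 2 - inner ℝ q r ^ 2)) := by
  let b := EuclideanSpace.basisFun (Fin 2) ℝ
  let f : EuclideanSpace ℝ (Fin 2) →ₗ[ℝ] V := b.toBasis.constr ℝ ![q, r]
  have hf (i : Fin 2) : f (b i) = ![q, r] i := by
    rw [← b.coe_toBasis]
    exact b.toBasis.constr_basis ℝ ![q, r] i
  have hfv (v : EuclideanSpace ℝ (Fin 2)) : f v = v 0 • q + v 1 • r := by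
    conv_lhs => rw [← b.sum_repr v]
    rw [map_sum, Fin.sum_univ_two, map_smul, map_smul, hf, hf]
    rfl
  have hd : f.normDet = √(‖q‖ ^ 2 * ‖r‖ ^ 2 - inner ℝ q r ^ 2) := by
    have h := f.normDet_sq_eq_det_gram b
    rw [← Real.sqrt_sq f.normDet_nonneg]
    congr 1
    simp only [RCLike.ofReal_real_eq_id, id_eq] at h
    rw [h, Matrix.det_fin_two]
    simp only [Matrix.gram_apply, hf, Matrix.cons_val_zero, Matrix.cons_val_one,
      real_inner_self_eq_norm_sq, real_inner_comm r q]
    ring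
  have himg : cornerTriangle q r = f '' {v | 0 ≤ v 0 ∧ 0 ≤ v 1 ∧ v 0 + v 1 ≤ 1} := by
    ext x
    constructor
    · rintro ⟨α, β, h1, h2, h3, rfl⟩
      exact ⟨!₂[α, β], ⟨by simpa, by simpa, by simpa⟩, by simp [hfv]⟩
    · rintro ⟨v, ⟨h1, h2, h3⟩, rfl⟩
      exact ⟨v 0, v 1, h1, h2, h3, hfv v⟩
  have h2 := f.euclideanHausdorffMeasure_image_eq_normDet_mul_volume
    {v | 0 ≤ v 0 ∧ 0 ≤ v 1 ∧ v 0 + v 1 ≤ 1}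
  rw [finrank_euclideanSpace_fin, volume_stdTriangle, ← himg, hd,
    ← ENNReal.ofReal_mul (Real.sqrt_nonneg _)] at h2
  rw [h2, mul_comm]

theorem doubleTriangle_eq_union (q r : V) :
    doubleTriangle q r = cornerTriangle q r ∪ cornerTriangle (-q) (-r) := by
  ext x
  constructor
  · rintro ⟨α, β, h1, h2, rfl⟩
    rcases mul_nonneg_iff.1 h1 with ⟨ha, hb⟩ | ⟨ha, hb⟩
    · rw [abs_of_nonneg ha, abs_of_nonneg hb] at h2
      exact Or.inl ⟨α, β, ha, hb, h2, rfl⟩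
    · rw [abs_of_nonpos ha, abs_of_nonpos hb] at h2
      exact Or.inr ⟨-α, -β, by linarith, by linarith, h2, by simp⟩
  · rintro (⟨α, β, h1, h2, h3, rfl⟩ | ⟨α, β, h1, h2, h3, rfl⟩)
    · exact ⟨α, β, mul_nonneg h1 h2, by rwa [abs_of_nonneg h1, abs_of_nonneg h2], rfl⟩
    · exact ⟨-α, -β, by simpa using mul_nonneg h1 h2,
        by rwa [abs_neg, abs_neg, abs_of_nonneg h1, abs_of_nonneg h2], by simp⟩

theorem isClosed_cornerTriangle (q r : V) : IsClosed (cornerTriangle q r) := by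
  have h : cornerTriangle q r = (fun p : ℝ × ℝ => p.1 • q + p.2 • r) ''
      {p : ℝ × ℝ | 0 ≤ p.1 ∧ 0 ≤ p.2 ∧ p.1 + p.2 ≤ 1} := by
    ext x
    constructor
    · rintro ⟨α, β, h1, h2, h3, rfl⟩
      exact ⟨(α, β), ⟨h1, h2, h3⟩, rfl⟩
    · rintro ⟨⟨α, β⟩, ⟨h1, h2, h3⟩, rfl⟩
      exact ⟨α, β, h1, h2, h3, rfl⟩
  have hc : IsCompact {p : ℝ × ℝ | 0 ≤ p.1 ∧ 0 ≤ p.2 ∧ p.1 + p.2 ≤ 1} := by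
    refine (isCompact_Icc (a := ((0, 0) : ℝ × ℝ)) (b := (1, 1))).of_isClosed_subset ?_ ?_
    · exact (isClosed_le continuous_const continuous_fst).inter
        ((isClosed_le continuous_const continuous_snd).inter
          (isClosed_le (continuous_fst.add continuous_snd) continuous_const))
    · rintro ⟨a, b⟩ ⟨h1, h2, h3⟩
      simp only at h1 h2 h3
      exact ⟨⟨h1, h2⟩, ⟨by simp only; linarith, by simp only; linarith⟩⟩
  rw [h]
  exact (hc.image (by fun_prop)).isClosed

theorem isClosed_doubleTriangle (q r : V) : IsClosed (doubleTriangle q r) := by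
  rw [doubleTriangle_eq_union]
  exact (isClosed_cornerTriangle q r).union (isClosed_cornerTriangle _ _)

theorem volume_doubleTriangle [MeasurableSpace V] [BorelSpace V] [FiniteDimensional ℝ V]
    (hV : finrank ℝ V = 2) {q r : V}
    (h : LinearIndependent ℝ ![q, r]) :
    volume (doubleTriangle q r) = ENNReal.ofReal (√(‖q‖ ^ 2 * ‖r‖ ^ 2 - inner ℝ q r ^ 2)) := by
  have hvol : (volume : Measure V) = μHE[2] := by
    rw [← hV]
    exact InnerProductSpace.euclideanHausdorffMeasure_eq_volume.symm
  have : Nontrivial V := Module.nontrivial_of_finrank_pos (R := ℝ) (by omega)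
  rw [doubleTriangle_eq_union, measure_union₀ (isClosed_cornerTriangle _ _).nullMeasurableSet,
    hvol, euclideanHausdorffMeasure_cornerTriangle, euclideanHausdorffMeasure_cornerTriangle,
    ← ENNReal.ofReal_add (by positivity) (by positivity)]
  · congr 1
    simp only [norm_neg, inner_neg_neg]
    ring
  · refine measure_mono_null (t := {0}) ?_ (measure_singleton _)
    rintro x ⟨⟨α, β, h1, h2, -, hx⟩, ⟨γ, δ, h3, h4, -, hy⟩⟩
    -- A common point has nonnegative coefficients with respect to `q`, `r` and also to `-q`, `-r`;
    -- independence makes the sums vanish, hence every coefficient.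
    have h5 : (α + γ) • q + (β + δ) • r = 0 := by
      rw [add_smul, add_smul, add_add_add_comm, ← hx, hy]
      module
    obtain ⟨h6, h7⟩ := LinearIndependent.pair_iff.1 h _ _ h5
    rw [Set.mem_singleton_iff, hx, show α = 0 by linarith, show β = 0 by linarith]
    simp

end Areas

/-! ### Intersections of symmetric strips: boundary, its length, extreme points -/

section Bands

open Module

/-- The intersection of the symmetric strips `|ℓ k| ≤ 1`. -/
def bandPolytope {ι V : Type*} [NormedAddCommGroup V] [NormedSpace ℝ V] (ℓ : ι → V →L[ℝ] ℝ) :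
    Set V :=
  {x | ∀ k, |ℓ k x| ≤ 1}

variable {ι V : Type*} [NormedAddCommGroup V] [NormedSpace ℝ V]

theorem isClosed_bandPolytope (ℓ : ι → V →L[ℝ] ℝ) : IsClosed (bandPolytope ℓ) := by
  have : bandPolytope ℓ = ⋂ k, {x | |ℓ k x| ≤ 1} := by ext; simp [bandPolytope]
  rw [this]
  exact isClosed_iInter fun k => isClosed_le (by fun_prop) continuous_const

theorem convex_bandPolytope (ℓ : ι → V →L[ℝ] ℝ) : Convex ℝ (bandPolytope ℓ) := by
  intro x hx y hy a b ha hb hab k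
  have h1 := abs_le.1 (hx k)
  have h2 := abs_le.1 (hy k)
  simp only [map_add, map_smul, smul_eq_mul]
  rw [abs_le]
  constructor <;> nlinarith

/-- Finitely many strict inequalities define an open set. Conversely, if some `|ℓ k x| = 1`, the
points `t • x` with `t > 1` leave the set and approach `x`. -/
theorem frontier_bandPolytope [Finite ι] (ℓ : ι → V →L[ℝ] ℝ) :
    frontier (bandPolytope ℓ) = {x | x ∈ bandPolytope ℓ ∧ ∃ k, |ℓ k x| = 1} := by
  rw [(isClosed_bandPolytope ℓ).frontier_eq]
  ext x
  refine and_congr_right fun hx => ?_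
  constructor
  · intro h
    by_contra hne
    push Not at hne
    refine h (mem_interior.2 ⟨{y | ∀ k, |ℓ k y| < 1}, fun y hy k => (hy k).le, ?_, ?_⟩)
    · have : {y | ∀ k, |ℓ k y| < 1} = ⋂ k, {y | |ℓ k y| < 1} := by ext; simp
      rw [this]
      exact isOpen_iInter_of_finite fun k => isOpen_lt (by fun_prop) continuous_const
    · exact fun k => lt_of_le_of_ne (hx k) (hne k)
  · rintro ⟨k, hk⟩ h
    have hc : Filter.Tendsto (fun t : ℝ => t • x) (nhdsWithin 1 (Set.Ioi 1)) (nhds x) := by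
      have : Filter.Tendsto (fun t : ℝ => t • x) (nhds 1) (nhds ((1 : ℝ) • x)) :=
        (continuous_id.smul continuous_const).tendsto 1
      rw [one_smul] at this
      exact this.mono_left nhdsWithin_le_nhds
    obtain ⟨t, ht, ht1⟩ := ((hc.eventually (mem_interior_iff_mem_nhds.1 h)).and
      self_mem_nhdsWithin).exists
    have h1 := ht k
    rw [map_smul, smul_eq_mul, abs_mul, hk, mul_one, abs_of_pos (zero_lt_one.trans ht1)] at h1
    exact absurd ht1 (not_lt.2 h1)

/-- The boundary consists of the sides `ℓ k = 1` and their reflections `ℓ k = -1`, which have the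
same length. Sides of different strips share at most one point, since two functionals determine a
vector, so the lengths add. -/
theorem hausdorffMeasure_frontier_bandPolytope [Fintype ι] [MeasurableSpace V] [BorelSpace V]
    (ℓ : ι → V →L[ℝ] ℝ) (hℓ : ∀ i j, i ≠ j → ∀ x, ℓ i x = 0 → ℓ j x = 0 → x = 0) (a b : ι → V)
    (hab : ∀ k, {x | x ∈ bandPolytope ℓ ∧ ℓ k x = 1} = segment ℝ (a k) (b k)) :
    (μH[1] (frontier (bandPolytope ℓ))).toReal = ∑ k, 2 * dist (a k) (b k) := by
  let s : Bool → ℝ := fun e => if e then 1 else -1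
  let G : ι × Bool → Set V := fun p => {x | x ∈ bandPolytope ℓ ∧ ℓ p.1 x = s p.2}
  have hG : frontier (bandPolytope ℓ) = ⋃ p, G p := by
    rw [frontier_bandPolytope]
    ext x
    simp only [Set.mem_iUnion, Prod.exists, Bool.exists_bool, G, s, Set.mem_ofPred_eq]
    constructor
    · rintro ⟨hx, k, hk⟩
      rcases eq_or_eq_neg_of_abs_eq hk with h | h
      · exact ⟨k, Or.inr ⟨hx, by simpa using h⟩⟩
      · exact ⟨k, Or.inl ⟨hx, by simpa using h⟩⟩
    · rintro ⟨k, ⟨hx, h⟩ | ⟨hx, h⟩⟩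
      · exact ⟨hx, k, by rw [h]; simp⟩
      · exact ⟨hx, k, by rw [h]; simp⟩
  have hcl (p : ι × Bool) : IsClosed (G p) :=
    (isClosed_bandPolytope ℓ).inter (isClosed_eq (by fun_prop) continuous_const)
  have hseg (k : ι) (e : Bool) : G (k, e) = segment ℝ (s e • a k) (s e • b k) := by
    cases e
    · have h1 : G (k, false) = (fun x => -x) '' segment ℝ (a k) (b k) := by
        rw [← hab]
        ext x
        simp only [G, s, Set.mem_image, Set.mem_ofPred_eq, bandPolytope]
        constructor
        · rintro ⟨h, h'⟩
          exact ⟨-x, ⟨fun j => by simpa using h j, by simp [h']⟩, neg_neg x⟩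
        · rintro ⟨y, ⟨h, h'⟩, rfl⟩
          exact ⟨fun j => by simpa using h j, by simp [h']⟩
      rw [h1]
      have := image_segment ℝ (LinearMap.toAffineMap (-LinearMap.id : V →ₗ[ℝ] V)) (a k) (b k)
      simpa [s] using this
    · have h1 : G (k, true) = segment ℝ (a k) (b k) := by
        rw [← hab]
        simp [G, s]
      simpa [s] using h1
  have hμ (k : ι) (e : Bool) : μH[1] (G (k, e)) = ENNReal.ofReal (dist (a k) (b k)) := by
    rw [hseg, hausdorffMeasure_segment, edist_dist]
    cases e <;> simp [s]
  have hdisj : Pairwise (Function.onFun (AEDisjoint μH[1]) G) := by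
    rintro ⟨k, e⟩ ⟨k', e'⟩ hne
    have := Measure.nullSingletonClass_hausdorff V (zero_lt_one : (0 : ℝ) < 1)
    refine Set.Subsingleton.measure_zero ?_ _
    rintro x ⟨⟨-, hx1⟩, ⟨-, hx2⟩⟩ y ⟨⟨-, hy1⟩, ⟨-, hy2⟩⟩
    simp only at hx1 hx2 hy1 hy2
    by_cases hk : k = k'
    · subst hk
      exfalso
      apply hne
      have : s e = s e' := hx1.symm.trans hx2
      congr 1
      cases e <;> cases e' <;> simp [s] at this ⊢ <;> linarith
    · exact sub_eq_zero.1 (hℓ k k' hk (x - y) (by simp [hx1, hy1]) (by simp [hx2, hy2]))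
  rw [hG, measure_iUnion₀ hdisj fun p => (hcl p).nullMeasurableSet, tsum_fintype,
    Fintype.sum_prod_type]
  simp only [Fintype.sum_bool, hμ]
  rw [ENNReal.toReal_sum (by simp)]
  refine Finset.sum_congr rfl fun k _ => ?_
  rw [← ENNReal.ofReal_add dist_nonneg dist_nonneg, ENNReal.toReal_ofReal (by positivity)]
  ring

/-- A functional that is extremal at a proper convex combination takes the same value at both
endpoints; two functionals without common kernel then identify the endpoint with `v`. -/
theorem mem_extremePoints_bandPolytope (ℓ : ι → V →L[ℝ] ℝ) {i j : ι}
    (hℓ : ∀ x, ℓ i x = 0 → ℓ j x = 0 → x = 0) {v : V} (hv : v ∈ bandPolytope ℓ)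
    (hi : |ℓ i v| = 1) (hj : |ℓ j v| = 1) : v ∈ Set.extremePoints ℝ (bandPolytope ℓ) := by
  refine ⟨hv, fun x hx y hy hxy => ?_⟩
  obtain ⟨a, b, ha, hb, hab, rfl⟩ := hxy
  have key (k : ι) (hk : |ℓ k (a • x + b • y)| = 1) : ℓ k (x - (a • x + b • y)) = 0 := by
    have h1 := abs_le.1 (hx k)
    have h2 := abs_le.1 (hy k)
    simp only [map_add, map_sub, map_smul, smul_eq_mul] at hk ⊢
    rcases eq_or_eq_neg_of_abs_eq hk with h | h <;> rw [h]
    · nlinarith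
    · nlinarith
  exact sub_eq_zero.1 (hℓ _ (key i hi) (key j hj))

end Bands

/-! ### Metric data of the hull of three opposite pairs of points in a plane -/

section SymmetricHexagon

open Module

variable {V : Type*} [NormedAddCommGroup V] [InnerProductSpace ℝ V]

/-- The convex hull of the six points `± p`, `± q`, `± m`. -/
def symmetricHexagon (p q m : V) : Set V := convexHull ℝ {p, -p, q, -q, m, -m}

theorem doubleTriangle_subset {C : Set V} (hC : Convex ℝ C) {q r : V} (hq : q ∈ C) (hq' : -q ∈ C)
    (hr : r ∈ C) (hr' : -r ∈ C) : doubleTriangle q r ⊆ C := by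
  have h0 : (0 : V) ∈ C := by
    have := hC hq hq' (show (0 : ℝ) ≤ 1 / 2 by norm_num) (show (0 : ℝ) ≤ 1 / 2 by norm_num)
      (by norm_num)
    simpa using this
  have key : ∀ q r : V, q ∈ C → r ∈ C → cornerTriangle q r ⊆ C := by
    rintro q r hq hr _ ⟨α, β, h1, h2, h3, rfl⟩
    have := hC.sum_mem (t := Finset.univ) (w := ![α, β, 1 - α - β]) (z := ![q, r, 0])
      (by intro i _; fin_cases i <;> simp <;> linarith) (by simp [Fin.sum_univ_three])
      (by intro i _; fin_cases i <;> simp [hq, hr, h0])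
    simpa [Fin.sum_univ_three] using this
  rw [doubleTriangle_eq_union]
  exact Set.union_subset (key _ _ hq hr) (key _ _ hq' hr')

theorem exists_coordinates [FiniteDimensional ℝ V] (hV : finrank ℝ V = 2) {p q : V}
    (h : LinearIndependent ℝ ![p, q]) :
    ∃ α β : V →L[ℝ] ℝ, (∀ x, x = α x • p + β x • q) ∧ α p = 1 ∧ α q = 0 ∧ β p = 0 ∧ β q = 1 := by
  let b := basisOfLinearIndependentOfCardEqFinrank h (by simp [hV])
  have hb0 : b 0 = p := by simp [b]
  have hb1 : b 1 = q := by simp [b]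
  refine ⟨LinearMap.toContinuousLinearMap (b.coord 0), LinearMap.toContinuousLinearMap (b.coord 1),
    fun x => ?_, ?_, ?_, ?_, ?_⟩
  · have := b.sum_repr x
    rw [Fin.sum_univ_two, hb0, hb1] at this
    simpa using this.symm
  all_goals first | rw [← hb0] | rw [← hb1]
  all_goals simp

theorem volume_ker_eq_zero [MeasurableSpace V] [BorelSpace V] [FiniteDimensional ℝ V]
    (f : V →L[ℝ] ℝ) {x : V} (hx : f x ≠ 0) : volume {y | f y = 0} = 0 := by
  have h := Measure.addHaar_submodule (volume : Measure V) f.ker (by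
    intro h
    apply hx
    have : x ∈ f.ker := by rw [h]; trivial
    exact this)
  exact h

theorem linearIndependent_combination {p q : V} (h : LinearIndependent ℝ ![p, q]) {a b c d : ℝ}
    (hd : a * d - b * c ≠ 0) : LinearIndependent ℝ ![a • p + b • q, c • p + d • q] := by
  rw [LinearIndependent.pair_iff] at h ⊢
  intro s t hst
  obtain ⟨h1, h2⟩ := h (s * a + t * c) (s * b + t * d) (by rw [← hst]; module)
  constructor
  · refine (mul_eq_zero.1 (?_ : s * (a * d - b * c) = 0)).resolve_right hd
    linear_combination d * h1 - c * h2
  · refine (mul_eq_zero.1 (?_ : t * (a * d - b * c) = 0)).resolve_right hd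
    linear_combination a * h2 - b * h1

theorem gram_combination (p q : V) (a b c d : ℝ) :
    ‖a • p + b • q‖ ^ 2 * ‖c • p + d • q‖ ^ 2 - inner ℝ (a • p + b • q) (c • p + d • q) ^ 2 =
      (a * d - b * c) ^ 2 * (‖p‖ ^ 2 * ‖q‖ ^ 2 - inner ℝ p q ^ 2) := by
  simp only [← real_inner_self_eq_norm_sq, inner_add_left, inner_add_right, real_inner_smul_left,
    real_inner_smul_right, real_inner_comm p q]
  ring

theorem volume_doubleTriangle_combination [MeasurableSpace V] [BorelSpace V]
    [FiniteDimensional ℝ V] (hV : finrank ℝ V = 2) {p q : V} (h : LinearIndependent ℝ ![p, q])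
    {a b c d : ℝ} (hd : 0 < a * d - b * c) :
    volume (doubleTriangle (a • p + b • q) (c • p + d • q)) =
      ENNReal.ofReal ((a * d - b * c) * √(‖p‖ ^ 2 * ‖q‖ ^ 2 - inner ℝ p q ^ 2)) := by
  rw [volume_doubleTriangle hV (linearIndependent_combination h hd.ne'), gram_combination,
    Real.sqrt_mul (sq_nonneg _), Real.sqrt_sq hd.le]

/-! ### The degenerate case: `± m` inside the parallelogram of `± p`, `± q` -/

section Parallelogram

variable {p q m : V} {lam mu : ℝ}

/-- All three sets are `|α| + |β| ≤ 1`. The inclusions run in a cycle: hull in strips because the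
generators are, strips in triangles by the sign of `α β`, triangles in hull by convexity. The strips
serve the perimeter and the vertices, the triangles the area. -/
theorem symmetricHexagon_eq_bandPolytope_of_le {α β : V →L[ℝ] ℝ}
    (hx : ∀ x, x = α x • p + β x • q) (hαp : α p = 1) (hαq : α q = 0) (hβp : β p = 0)
    (hβq : β q = 1) (hm : m = lam • p + mu • q) (hl : 0 ≤ lam) (hu : 0 ≤ mu)
    (hlu : lam + mu ≤ 1) :
    symmetricHexagon p q m = bandPolytope ![α + β, α - β] ∧
      symmetricHexagon p q m = doubleTriangle p q ∪ doubleTriangle p (-q) := by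
  have h1 : symmetricHexagon p q m ⊆ bandPolytope ![α + β, α - β] := by
    refine convexHull_min ?_ (convex_bandPolytope _)
    intro v hv k
    simp only [Set.mem_insert_iff, Set.mem_singleton_iff] at hv
    rw [abs_le]
    rcases hv with rfl | rfl | rfl | rfl | rfl | rfl <;> fin_cases k <;>
      simp [hm, hαp, hαq, hβp, hβq] <;> constructor <;> linarith
  have h2 : bandPolytope ![α + β, α - β] ⊆ doubleTriangle p q ∪ doubleTriangle p (-q) := by
    intro v hv
    have hv0 : |α v + β v| ≤ 1 := hv 0
    have hv1 : |α v - β v| ≤ 1 := hv 1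
    rcases le_total 0 (α v * β v) with h | h
    · refine Or.inl ⟨α v, β v, h, ?_, hx v⟩
      rwa [← abs_add_eq_add_abs_iff _ _ |>.2 (mul_nonneg_iff.1 h)]
    · refine Or.inr ⟨α v, -β v, by linarith, ?_, by simpa using hx v⟩
      rwa [← abs_add_eq_add_abs_iff _ _ |>.2 (mul_nonneg_iff.1 (by linarith)), ← sub_eq_add_neg]
  have hC : Convex ℝ (symmetricHexagon p q m) := convex_convexHull ℝ _
  have hsub := subset_convexHull ℝ ({p, -p, q, -q, m, -m} : Set V)
  have h3 : doubleTriangle p q ∪ doubleTriangle p (-q) ⊆ symmetricHexagon p q m := by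
    refine Set.union_subset (doubleTriangle_subset hC ?_ ?_ ?_ ?_)
      (doubleTriangle_subset hC ?_ ?_ ?_ ?_) <;> apply hsub <;> simp
  exact ⟨h1.antisymm (h2.trans h3), (h1.trans h2).antisymm h3⟩

variable [FiniteDimensional ℝ V]

theorem volume_symmetricHexagon_of_le [MeasurableSpace V] [BorelSpace V] (hV : finrank ℝ V = 2)
    (h : LinearIndependent ℝ ![p, q]) (hm : m = lam • p + mu • q) (hl : 0 ≤ lam) (hu : 0 ≤ mu)
    (hlu : lam + mu ≤ 1) :
    (volume (symmetricHexagon p q m)).toReal = 2 * √(‖p‖ ^ 2 * ‖q‖ ^ 2 - inner ℝ p q ^ 2) := by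
  obtain ⟨α, β, hx, hαp, hαq, hβp, hβq⟩ := exists_coordinates hV h
  rw [(symmetricHexagon_eq_bandPolytope_of_le hx hαp hαq hβp hβq hm hl hu hlu).2,
    measure_union₀ (isClosed_doubleTriangle _ _).nullMeasurableSet, volume_doubleTriangle hV h,
    volume_doubleTriangle hV, inner_neg_right, norm_neg, neg_sq,
    ← ENNReal.ofReal_add (Real.sqrt_nonneg _) (Real.sqrt_nonneg _),
    ENNReal.toReal_ofReal (by positivity)]
  · ring
  · have := linearIndependent_combination h (a := 1) (b := 0) (c := 0) (d := -1) (by norm_num)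
    simpa using this
  -- The double triangles lie in `α β ≥ 0` and `α β ≤ 0`, so they overlap only on the two coordinate
  -- lines.
  · have h1 := volume_ker_eq_zero α (x := p) (by rw [hαp]; norm_num)
    have h2 := volume_ker_eq_zero β (x := q) (by rw [hβq]; norm_num)
    refine measure_mono_null ?_ (measure_union_null h1 h2)
    rintro x ⟨⟨a, b, hab, -, rfl⟩, ⟨c, d, hcd, -, hxx⟩⟩
    have e1 := congrArg α hxx
    have e2 := congrArg β hxx
    simp [hαp, hαq, hβp, hβq] at e1 e2 ⊢
    subst e1 e2
    have : a * d = 0 := by linarith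
    rcases mul_eq_zero.1 this with h | h
    · exact Or.inl h
    · exact Or.inr (neg_eq_zero.2 h)

theorem hausdorffMeasure_frontier_symmetricHexagon_of_le [MeasurableSpace V] [BorelSpace V]
    (hV : finrank ℝ V = 2)
    (h : LinearIndependent ℝ ![p, q]) (hm : m = lam • p + mu • q) (hl : 0 ≤ lam) (hu : 0 ≤ mu)
    (hlu : lam + mu ≤ 1) :
    (μH[1] (frontier (symmetricHexagon p q m))).toReal = 2 * (dist p q + dist p (-q)) := by
  obtain ⟨α, β, hx, hαp, hαq, hβp, hβq⟩ := exists_coordinates hV h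
  rw [(symmetricHexagon_eq_bandPolytope_of_le hx hαp hαq hβp hβq hm hl hu hlu).1,
    hausdorffMeasure_frontier_bandPolytope _ _ ![p, p] ![q, -q]]
  · simp
    ring
  · intro k
    ext x
    rw [segment_eq_image']
    fin_cases k
    · simp only [bandPolytope, Fin.forall_fin_two, Set.mem_ofPred_eq, Set.mem_image, Fin.zero_eta,
        Matrix.cons_val_zero, Matrix.cons_val_one, add_apply,
        sub_apply]
      constructor
      · rintro ⟨⟨-, h2⟩, h3⟩
        rw [abs_le] at h2
        refine ⟨β x, ⟨by linarith, by linarith⟩, ?_⟩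
        conv_rhs => rw [hx x, show α x = 1 - β x by linarith]
        module
      · rintro ⟨t, ht, rfl⟩
        simp [hαp, hαq, hβp, hβq, abs_le]
        constructor <;> linarith [ht.1, ht.2]
    · simp only [bandPolytope, Fin.forall_fin_two, Set.mem_ofPred_eq, Set.mem_image, Fin.mk_one,
        Matrix.cons_val_zero, Matrix.cons_val_one, add_apply,
        sub_apply]
      constructor
      · rintro ⟨⟨h2, -⟩, h3⟩
        rw [abs_le] at h2
        refine ⟨-β x, ⟨by linarith, by linarith⟩, ?_⟩
        conv_rhs => rw [hx x, show α x = 1 + β x by linarith]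
        module
      · rintro ⟨t, ht, rfl⟩
        simp [hαp, hαq, hβp, hβq, abs_le]
        constructor <;> linarith [ht.1, ht.2]
  · intro i j hij x h1 h2
    have : α x = 0 ∧ β x = 0 := by
      fin_cases i <;> fin_cases j <;> simp at hij h1 h2 <;> constructor <;> linarith
    rw [hx x, this.1, this.2]
    simp

theorem ncard_extremePoints_symmetricHexagon_of_le (hV : finrank ℝ V = 2)
    (h : LinearIndependent ℝ ![p, q]) (hm : m = lam • p + mu • q) (hl : 0 ≤ lam) (hu : 0 ≤ mu)
    (hlu : lam + mu ≤ 1) :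
    (Set.extremePoints ℝ (symmetricHexagon p q m)).ncard = 4 := by
  obtain ⟨α, β, hx, hαp, hαq, hβp, hβq⟩ := exists_coordinates hV h
  have hP := symmetricHexagon_eq_bandPolytope_of_le hx hαp hαq hβp hβq hm hl hu hlu
  -- The strips do not depend on `m`. Replacing `m` by `p` presents the same set as the hull of `±
  -- p`, `± q` alone, which excludes `± m` as further extreme points.
  have hP0 := symmetricHexagon_eq_bandPolytope_of_le hx hαp hαq hβp hβq (m := p) (lam := 1)
    (mu := 0) (by simp) zero_le_one le_rfl (by norm_num)
  have hE : Set.extremePoints ℝ (symmetricHexagon p q m) = {p, -p, q, -q} := by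
    rw [hP.1]
    apply Set.Subset.antisymm
    · rw [← hP0.1]
      refine extremePoints_convexHull_subset.trans ?_
      rintro v (h | h | h | h | h | h) <;> simp [Set.mem_singleton_iff.1 h]
    · intro v hv
      simp only [Set.mem_insert_iff, Set.mem_singleton_iff] at hv
      refine mem_extremePoints_bandPolytope _ (i := 0) (j := 1) ?_ ?_ ?_ ?_
      · intro x h1 h2
        simp at h1 h2
        rw [hx x, show α x = 0 by linarith, show β x = 0 by linarith]
        simp
      · rw [← hP.1]
        apply subset_convexHull
        simp only [Set.mem_insert_iff, Set.mem_singleton_iff]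
        tauto
      all_goals rcases hv with rfl | rfl | rfl | rfl <;> simp [hαp, hαq, hβp, hβq]
  have hne : ∀ {v w : V}, (α v ≠ α w ∨ β v ≠ β w) → v ≠ w := by
    rintro v w h rfl
    simp at h
  rw [hE, Set.ncard_insert_of_notMem, Set.ncard_insert_of_notMem, Set.ncard_pair]
  · apply hne; simp [hαp, hαq, hβp, hβq]; norm_num
  all_goals simp only [Set.mem_insert_iff, Set.mem_singleton_iff, not_or]
  · refine ⟨hne ?_, hne ?_⟩ <;> simp [hαp, hαq, hβp, hβq]
  · refine ⟨hne ?_, hne ?_, hne ?_⟩ <;> simp [hαp, hαq, hβp, hβq] <;> norm_num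

end Parallelogram

/-! ### The genuine hexagon: `m` beyond the segment from `p` to `q` -/

section Hexagon

variable {p q m : V} {lam mu : ℝ}

/-- The linear functionals that cut out the hexagon with vertices `± p`, `± q`,
`± (lam • p + mu • q)`, expressed by the coordinates `α`, `β` with respect to `p`, `q`. -/
noncomputable def hexagonFunctionals (α β : V →L[ℝ] ℝ) (lam mu : ℝ) : Fin 3 → V →L[ℝ] ℝ :=
  ![α + ((1 - lam) / mu) • β, ((1 - mu) / lam) • α + β, β - α]

/-- The functionals equal 1 on the lines through `p, m`, through `m, q` and through `q, -p`
respectively. Clearing denominators leaves inequalities polynomial in `lam`, `mu` and the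
coordinates. -/
theorem mem_bandPolytope_hexagonFunctionals {α β : V →L[ℝ] ℝ} (hl : 0 < lam) (hu : 0 < mu)
    {x : V} : x ∈ bandPolytope (hexagonFunctionals α β lam mu) ↔
      |mu * α x + (1 - lam) * β x| ≤ mu ∧ |(1 - mu) * α x + lam * β x| ≤ lam ∧
        |β x - α x| ≤ 1 := by
  have h1 : α x + (1 - lam) / mu * β x = (mu * α x + (1 - lam) * β x) / mu := by field_simp
  have h2 : (1 - mu) / lam * α x + β x = ((1 - mu) * α x + lam * β x) / lam := by field_simp
  simp only [bandPolytope, hexagonFunctionals, Set.mem_ofPred_eq, Fin.forall_fin_succ,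
    Matrix.cons_val_zero, add_apply, sub_apply, Matrix.cons_val_succ, smul_apply,
    smul_eq_mul, h1, h2, abs_div, abs_of_pos hu, abs_of_pos hl, div_le_one hu, div_le_one hl]
  simp

/-- The same cycle of inclusions as for the parallelogram. The lines through `p`, `m`, `q` cut the
plane into three double sectors, told apart by the signs of `α β` and of `mu α - lam β`; in each of
them one strip inequality is exactly the bound on the triangle coordinates. -/
theorem symmetricHexagon_eq_bandPolytope {α β : V →L[ℝ] ℝ}
    (hx : ∀ x, x = α x • p + β x • q) (hαp : α p = 1) (hαq : α q = 0) (hβp : β p = 0)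
    (hβq : β q = 1) (hm : m = lam • p + mu • q) (hl : 0 < lam) (hu : 0 < mu) (hl1 : lam ≤ 1)
    (hu1 : mu ≤ 1) (hlu : 1 < lam + mu) :
    symmetricHexagon p q m = bandPolytope (hexagonFunctionals α β lam mu) ∧
      symmetricHexagon p q m = doubleTriangle p m ∪ doubleTriangle m q ∪ doubleTriangle q (-p) := by
  have h1 : symmetricHexagon p q m ⊆ bandPolytope (hexagonFunctionals α β lam mu) := by
    refine convexHull_min ?_ (convex_bandPolytope _)
    intro v hv
    simp only [Set.mem_insert_iff, Set.mem_singleton_iff] at hv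
    rw [mem_bandPolytope_hexagonFunctionals hl hu]
    simp only [abs_le]
    rcases hv with rfl | rfl | rfl | rfl | rfl | rfl <;>
      refine ⟨⟨?_, ?_⟩, ⟨?_, ?_⟩, ⟨?_, ?_⟩⟩ <;> simp [hm, hαp, hαq, hβp, hβq] <;> nlinarith
  have h2 : bandPolytope (hexagonFunctionals α β lam mu) ⊆
      doubleTriangle p m ∪ doubleTriangle m q ∪ doubleTriangle q (-p) := by
    intro v hv
    obtain ⟨hv0, hv1, hv2⟩ := (mem_bandPolytope_hexagonFunctionals hl hu).1 hv
    rcases le_total (α v * β v) 0 with h | h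
    · refine Or.inr ⟨β v, -α v, by linarith, ?_, ?_⟩
      · rwa [← abs_add_eq_add_abs_iff _ _ |>.2 (mul_nonneg_iff.1 (by linarith)), ← sub_eq_add_neg]
      · conv_lhs => rw [hx v]
        module
    · rcases le_or_gt 0 (β v * (mu * α v - lam * β v)) with h' | h'
      -- The witnesses are the coordinates of `v` in the basis `p`, `m`, obtained by eliminating
      -- `q`.
      · refine Or.inl (Or.inl ⟨(mu * α v - lam * β v) / mu, β v / mu, ?_, ?_, ?_⟩)
        · rw [div_mul_div_comm]
          exact div_nonneg (by linarith) (by positivity)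
        · rw [abs_div, abs_div, abs_of_pos hu, ← add_div, div_le_one hu,
            ← (abs_add_eq_add_abs_iff _ _).2 (mul_nonneg_iff.1 (by linarith))]
          rwa [show mu * α v - lam * β v + β v = mu * α v + (1 - lam) * β v by ring]
        · conv_lhs => rw [hx v]
          rw [hm]
          match_scalars <;> field_simp
          simp
      -- If this failed, its product with the negative quantity in `h'` would be positive, while
      -- that product is `-(α β) (mu α - lam β)² ≤ 0`.
      · have h'' : 0 ≤ α v * (lam * β v - mu * α v) := by
          by_contra hcon
          push Not at hcon
          have h1 := mul_pos_of_neg_of_neg hcon h'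
          have h2 := mul_nonneg h (sq_nonneg (mu * α v - lam * β v))
          linarith
        refine Or.inl (Or.inr ⟨α v / lam, (lam * β v - mu * α v) / lam, ?_, ?_, ?_⟩)
        · rw [div_mul_div_comm]
          exact div_nonneg (by linarith) (by positivity)
        · rw [abs_div, abs_div, abs_of_pos hl, ← add_div, div_le_one hl,
            ← (abs_add_eq_add_abs_iff _ _).2 (mul_nonneg_iff.1 (by linarith))]
          rwa [show α v + (lam * β v - mu * α v) = (1 - mu) * α v + lam * β v by ring]
        · conv_lhs => rw [hx v]
          rw [hm]
          match_scalars <;> field_simp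
          simp
  have hC : Convex ℝ (symmetricHexagon p q m) := convex_convexHull ℝ _
  have hsub := subset_convexHull ℝ ({p, -p, q, -q, m, -m} : Set V)
  have h3 : doubleTriangle p m ∪ doubleTriangle m q ∪ doubleTriangle q (-p) ⊆
      symmetricHexagon p q m := by
    refine Set.union_subset (Set.union_subset (doubleTriangle_subset hC ?_ ?_ ?_ ?_)
      (doubleTriangle_subset hC ?_ ?_ ?_ ?_)) (doubleTriangle_subset hC ?_ ?_ ?_ ?_) <;>
      apply hsub <;> simp
  exact ⟨h1.antisymm (h2.trans h3), (h1.trans h2).antisymm h3⟩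

theorem hexagonFunctionals_independent {α β : V →L[ℝ] ℝ} (hx : ∀ x, x = α x • p + β x • q)
    (hl : 0 < lam) (hu : 0 < mu) (hl1 : lam ≤ 1) (hu1 : mu ≤ 1) (hlu : 1 < lam + mu)
    (i j : Fin 3) (hij : i ≠ j) (x : V) (h1 : hexagonFunctionals α β lam mu i x = 0)
    (h2 : hexagonFunctionals α β lam mu j x = 0) : x = 0 := by
  have e1 : α x + (1 - lam) / mu * β x = 0 → mu * α x + (1 - lam) * β x = 0 := by
    intro h
    field_simp at h
    linarith
  have e2 : (1 - mu) / lam * α x + β x = 0 → (1 - mu) * α x + lam * β x = 0 := by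
    intro h
    field_simp at h
    linarith
  have : α x = 0 ∧ β x = 0 := by
    have key : ∀ a b c d : ℝ, a * d - b * c ≠ 0 → a * α x + b * β x = 0 →
        c * α x + d * β x = 0 → α x = 0 ∧ β x = 0 := by
      intro a b c d hd h1 h2
      constructor
      · refine (mul_eq_zero.1 (?_ : (a * d - b * c) * α x = 0)).resolve_left hd
        linear_combination d * h1 - b * h2
      · refine (mul_eq_zero.1 (?_ : (a * d - b * c) * β x = 0)).resolve_left hd
        linear_combination a * h2 - c * h1
    -- This determinant is `lam + mu - 1`: the sides meeting at `m` are not parallel precisely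
    -- because `m` is off the line `pq`.
    have d1 : mu * lam - (1 - lam) * (1 - mu) ≠ 0 := by nlinarith
    have d2 : mu * 1 - (1 - lam) * (-1) ≠ 0 := by linarith
    have d3 : (1 - mu) * 1 - lam * (-1) ≠ 0 := by linarith
    fin_cases i <;> fin_cases j <;> simp [hexagonFunctionals] at hij h1 h2
    · exact key _ _ _ _ d1 (e1 h1) (e2 h2)
    · exact key _ _ _ _ d2 (e1 h1) (by linarith)
    · exact key _ _ _ _ d1 (e1 h2) (e2 h1)
    · exact key _ _ _ _ d3 (e2 h1) (by linarith)
    · exact key _ _ _ _ d2 (e1 h2) (by linarith)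
    · exact key _ _ _ _ d3 (e2 h2) (by linarith)
  rw [hx x, this.1, this.2]
  simp

variable [FiniteDimensional ℝ V]

theorem volume_symmetricHexagon [MeasurableSpace V] [BorelSpace V] (hV : finrank ℝ V = 2)
    (h : LinearIndependent ℝ ![p, q]) (hm : m = lam • p + mu • q) (hl : 0 < lam) (hu : 0 < mu)
    (hl1 : lam ≤ 1) (hu1 : mu ≤ 1) (hlu : 1 < lam + mu) :
    (volume (symmetricHexagon p q m)).toReal =
      (1 + lam + mu) * √(‖p‖ ^ 2 * ‖q‖ ^ 2 - inner ℝ p q ^ 2) := by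
  obtain ⟨α, β, hx, hαp, hαq, hβp, hβq⟩ := exists_coordinates hV h
  -- The three determinants are `mu`, `lam` and 1, whence the factor `1 + lam + mu`.
  have v1 := volume_doubleTriangle_combination hV h (a := 1) (b := 0) (c := lam) (d := mu)
    (by linarith)
  have v2 := volume_doubleTriangle_combination hV h (a := lam) (b := mu) (c := 0) (d := 1)
    (by linarith)
  have v3 := volume_doubleTriangle_combination hV h (a := 0) (b := 1) (c := -1) (d := 0)
    (by norm_num)
  simp only [one_smul, zero_smul, add_zero, zero_add, neg_smul, ← hm] at v1 v2 v3
  rw [(symmetricHexagon_eq_bandPolytope hx hαp hαq hβp hβq hm hl hu hl1 hu1 hlu).2,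
    measure_union₀ (isClosed_doubleTriangle _ _).nullMeasurableSet,
    measure_union₀ (isClosed_doubleTriangle _ _).nullMeasurableSet, v1, v2, v3,
    ← ENNReal.ofReal_add, ← ENNReal.ofReal_add, ENNReal.toReal_ofReal]
  · ring
  · ring_nf
    positivity
  · ring_nf
    positivity
  · ring_nf
    positivity
  · ring_nf
    positivity
  · ring_nf
    positivity
  · have h1 := volume_ker_eq_zero (mu • α - lam • β) (x := p) (by simp [hαp, hβp, hu.ne'])
    refine measure_mono_null ?_ h1
    rintro x ⟨⟨a, b, hab, -, rfl⟩, ⟨c, d, hcd, -, hxx⟩⟩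
    have e1 := congrArg α hxx
    have e2 := congrArg β hxx
    simp [hm, hαp, hαq, hβp, hβq] at e1 e2 ⊢
    -- A point `a p + b m = c m + d q` of the overlap must lie on the line of `m`. Solving for `c`
    -- and `d` turns `0 ≤ c d` into a sum of two nonpositive terms, as `0 ≤ a b`; hence `a = 0`.
    have e3 : mu * a = -(lam * d) := by linear_combination mu * e1 - lam * e2
    have e4 : mu * a + b * (mu * lam) - lam * (b * mu) = mu * a := by ring
    have e5 : c = a / lam + b := by field_simp; linarith
    have e6 : d = -(mu * a) / lam := by field_simp; linarith
    rw [e5, e6] at hcd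
    have e7 : 0 ≤ -(mu * (a ^ 2 / lam ^ 2)) - mu / lam * (a * b) := by
      convert hcd using 1
      field_simp
      ring
    have e8 : 0 ≤ mu / lam * (a * b) := by positivity
    have e9 : mu * (a ^ 2 / lam ^ 2) = 0 := le_antisymm (by linarith) (by positivity)
    have e10 : a = 0 := by
      simpa [hu.ne', hl.ne'] using e9
    simp [e10]
    ring
  · have h1 := volume_ker_eq_zero α (x := p) (by rw [hαp]; norm_num)
    have h2 := volume_ker_eq_zero β (x := q) (by rw [hβq]; norm_num)
    refine measure_mono_null ?_ (measure_union_null h1 h2)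
    rintro x ⟨hx1, ⟨c, d, hcd, -, rfl⟩⟩
    -- The first two double triangles lie in `α β ≥ 0` and the third in `α β ≤ 0`, so the overlap is
    -- again confined to the coordinate lines.
    have key : 0 ≤ α (c • q + d • -p) * β (c • q + d • -p) := by
      rcases hx1 with ⟨a, b, hab, -, hxx⟩ | ⟨a, b, hab, -, hxx⟩ <;> rw [hxx] <;>
        simp [hm, hαp, hαq, hβp, hβq]
      · nlinarith [mul_nonneg hab hu.le, mul_nonneg (mul_nonneg hl.le hu.le) (sq_nonneg b)]
      · nlinarith [mul_nonneg hab hl.le, mul_nonneg (mul_nonneg hl.le hu.le) (sq_nonneg a)]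
    simp [hαp, hαq, hβp, hβq] at key ⊢
    have : c * d = 0 := by nlinarith
    rcases mul_eq_zero.1 this with h | h
    · exact Or.inr h
    · exact Or.inl h

theorem hausdorffMeasure_frontier_symmetricHexagon [MeasurableSpace V] [BorelSpace V]
    (hV : finrank ℝ V = 2)
    (h : LinearIndependent ℝ ![p, q]) (hm : m = lam • p + mu • q) (hl : 0 < lam) (hu : 0 < mu)
    (hl1 : lam ≤ 1) (hu1 : mu ≤ 1) (hlu : 1 < lam + mu) :
    (μH[1] (frontier (symmetricHexagon p q m))).toReal =
      2 * (dist p m + dist m q + dist q (-p)) := by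
  obtain ⟨α, β, hx, hαp, hαq, hβp, hβq⟩ := exists_coordinates hV h
  rw [(symmetricHexagon_eq_bandPolytope hx hαp hαq hβp hβq hm hl hu hl1 hu1 hlu).1,
    hausdorffMeasure_frontier_bandPolytope _
      (hexagonFunctionals_independent hx hl hu hl1 hu1 hlu) ![p, m, q] ![m, q, -p]]
  · simp [Fin.sum_univ_three]
    ring
  · intro k
    ext x
    rw [segment_eq_image', Set.mem_ofPred_eq, mem_bandPolytope_hexagonFunctionals hl hu]
    simp only [abs_le]
    fin_cases k
    · simp only [hexagonFunctionals, Set.mem_image, Fin.zero_eta, Matrix.cons_val_zero, add_apply,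
        smul_apply, smul_eq_mul]
      constructor
      · rintro ⟨⟨-, h2, h3⟩, h4⟩
        have h5 : α x = 1 - (1 - lam) / mu * β x := by linarith
        have h6 : mu * α x = mu - (1 - lam) * β x := by rw [h5]; field_simp
        -- This is the position along the side from `p` to `m`. The strip of the side `q, -p` makes
        -- it nonnegative and the strip of `m, q` bounds it by 1.
        refine ⟨β x / mu, ⟨div_nonneg ?_ hu.le, (div_le_one hu).2 ?_⟩, ?_⟩
        · have : 0 ≤ β x * (1 - lam + mu) := by nlinarith
          exact nonneg_of_mul_nonneg_left this (by linarith)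
        · have : (lam + mu - 1) * β x ≤ (lam + mu - 1) * mu := by nlinarith
          exact le_of_mul_le_mul_left this (by linarith)
        · conv_rhs => rw [hx x, h5]
          rw [hm]
          match_scalars <;> field_simp
          ring
      · rintro ⟨t, ht, rfl⟩
        simp [hm, hαp, hαq, hβp, hβq]
        have := ht.1
        have := ht.2
        refine ⟨⟨⟨?_, ?_⟩, ⟨?_, ?_⟩, ?_, ?_⟩, ?_⟩
        · nlinarith
        · nlinarith
        · nlinarith [mul_nonneg ht.1 hl.le, mul_nonneg ht.1 hu.le]
        · nlinarith
        · nlinarith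
        · nlinarith
        · field_simp
          ring
    · simp only [hexagonFunctionals, Set.mem_image, Fin.mk_one, Matrix.cons_val_one, add_apply,
        Matrix.cons_val_zero, smul_apply, smul_eq_mul]
      constructor
      · rintro ⟨⟨h2, -, h3⟩, h4⟩
        have h5 : β x = 1 - (1 - mu) / lam * α x := by linarith
        have h6 : lam * β x = lam - (1 - mu) * α x := by rw [h5]; field_simp
        refine ⟨1 - α x / lam, ⟨sub_nonneg.2 ((div_le_one hl).2 ?_),
          sub_le_self _ (div_nonneg ?_ hl.le)⟩, ?_⟩
        · have : (lam + mu - 1) * α x ≤ (lam + mu - 1) * lam := by nlinarith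
          exact le_of_mul_le_mul_left this (by linarith)
        · have : 0 ≤ α x * (1 - mu + lam) := by nlinarith
          exact nonneg_of_mul_nonneg_left this (by linarith)
        · conv_rhs => rw [hx x, h5]
          rw [hm]
          match_scalars <;> field_simp <;> ring
      · rintro ⟨t, ht, rfl⟩
        simp [hm, hαp, hαq, hβp, hβq]
        have := ht.1
        have := ht.2
        have a1 : 0 ≤ t * lam := by positivity
        have a2 : 0 ≤ t * mu := by positivity
        have a3 : 0 ≤ (1 - t) * lam := mul_nonneg (by linarith) hl.le
        have a4 : 0 ≤ (1 - t) * mu := mul_nonneg (by linarith) hu.le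
        refine ⟨⟨⟨?_, ?_⟩, ⟨?_, ?_⟩, ?_, ?_⟩, ?_⟩
        · nlinarith
        · nlinarith
        · nlinarith
        · nlinarith
        · nlinarith
        · nlinarith
        · field_simp
          ring
    · simp only [hexagonFunctionals, Set.mem_image, Fin.reduceFinMk, Matrix.cons_val, sub_apply]
      constructor
      · rintro ⟨⟨h2, h3, -⟩, h4⟩
        have h5 : β x = 1 + α x := by linarith
        rw [h5] at h2 h3
        refine ⟨-α x, ⟨?_, ?_⟩, ?_⟩
        · have : α x * (1 - mu + lam) ≤ 0 := by nlinarith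
          have := nonpos_of_mul_nonpos_left this (by linarith)
          linarith
        · have : 0 ≤ (1 + α x) * (1 - lam + mu) := by nlinarith
          have := nonneg_of_mul_nonneg_left this (by linarith)
          linarith
        · conv_rhs => rw [hx x, h5]
          module
      · rintro ⟨t, ht, rfl⟩
        simp [hαp, hαq, hβp, hβq]
        have := ht.1
        have := ht.2
        have a1 : 0 ≤ t * lam := by positivity
        have a2 : 0 ≤ t * mu := by positivity
        have a3 : 0 ≤ (1 - t) * lam := mul_nonneg (by linarith) hl.le
        have a4 : 0 ≤ (1 - t) * mu := mul_nonneg (by linarith) hu.le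
        refine ⟨⟨?_, ?_⟩, ?_, ?_⟩ <;> nlinarith

/-- Every generator lies on two bounding lines and is therefore extreme. The coordinates separate
the six points because `lam` and `mu` are positive. -/
theorem ncard_extremePoints_symmetricHexagon (hV : finrank ℝ V = 2)
    (h : LinearIndependent ℝ ![p, q]) (hm : m = lam • p + mu • q) (hl : 0 < lam) (hu : 0 < mu)
    (hl1 : lam ≤ 1) (hu1 : mu ≤ 1) (hlu : 1 < lam + mu) :
    (Set.extremePoints ℝ (symmetricHexagon p q m)).ncard = 6 := by
  obtain ⟨α, β, hx, hαp, hαq, hβp, hβq⟩ := exists_coordinates hV h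
  have hαm : α m = lam := by simp [hm, hαp, hαq]
  have hβm : β m = mu := by simp [hm, hβp, hβq]
  have hP := symmetricHexagon_eq_bandPolytope hx hαp hαq hβp hβq hm hl hu hl1 hu1 hlu
  have hE : Set.extremePoints ℝ (symmetricHexagon p q m) = {p, -p, q, -q, m, -m} := by
    apply Set.Subset.antisymm
    · exact extremePoints_convexHull_subset
    · intro v hv
      have hvm := subset_convexHull ℝ _ hv
      have hind := hexagonFunctionals_independent hx hl hu hl1 hu1 hlu
      change v ∈ symmetricHexagon p q m at hvm
      rw [hP.1] at hvm ⊢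
      have e1 : lam + (1 - lam) / mu * mu = 1 := by field_simp; ring
      have e2 : (1 - mu) / lam * lam + mu = 1 := by field_simp; ring
      simp only [Set.mem_insert_iff, Set.mem_singleton_iff] at hv
      rcases hv with h | h | h | h | h | h
      · refine mem_extremePoints_bandPolytope _ (hind 0 2 (by decide)) hvm ?_ ?_ <;>
          simp [hexagonFunctionals, h, hαp, hβp]
      · refine mem_extremePoints_bandPolytope _ (hind 0 2 (by decide)) hvm ?_ ?_ <;>
          simp [hexagonFunctionals, h, hαp, hβp]
      · refine mem_extremePoints_bandPolytope _ (hind 1 2 (by decide)) hvm ?_ ?_ <;>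
          simp [hexagonFunctionals, h, hαq, hβq]
      · refine mem_extremePoints_bandPolytope _ (hind 1 2 (by decide)) hvm ?_ ?_ <;>
          simp [hexagonFunctionals, h, hαq, hβq]
      · refine mem_extremePoints_bandPolytope _ (hind 0 1 (by decide)) hvm ?_ ?_ <;>
          simp [hexagonFunctionals, h, hαm, hβm, hl.ne', hu.ne']
      · refine mem_extremePoints_bandPolytope _ (hind 0 1 (by decide)) hvm ?_ ?_ <;>
          simp only [hexagonFunctionals, h, map_neg, abs_neg, hαm, hβm, Matrix.cons_val_zero,
            Matrix.cons_val_one, add_apply, smul_apply, smul_eq_mul, e1, e2, abs_one]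
  have hne : ∀ {v w : V}, (α v ≠ α w ∨ β v ≠ β w) → v ≠ w := by
    rintro v w h rfl
    simp at h
  rw [hE, Set.ncard_insert_of_notMem, Set.ncard_insert_of_notMem, Set.ncard_insert_of_notMem,
    Set.ncard_insert_of_notMem, Set.ncard_pair]
  · apply hne
    left
    simp only [map_neg, hαm]
    linarith
  all_goals simp only [Set.mem_insert_iff, Set.mem_singleton_iff, not_or]
  · refine ⟨hne (Or.inl ?_), hne (Or.inl ?_)⟩ <;> simp [hαq, hαm, hl.ne, hl.ne']
  · refine ⟨hne (Or.inr ?_), hne (Or.inl ?_), hne (Or.inl ?_)⟩ <;>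
      simp [hβq, hαq, hαm, hl.ne, hl.ne'] <;> norm_num
  · refine ⟨hne (Or.inr ?_), hne (Or.inr ?_), hne (Or.inr ?_), hne (Or.inr ?_)⟩ <;>
      simp [hβp, hβq, hβm, hu.ne, hu.ne']
  · refine ⟨hne (Or.inl ?_), hne (Or.inr ?_), hne (Or.inr ?_), hne (Or.inr ?_),
      hne (Or.inr ?_)⟩ <;>
      simp [hαp, hβp, hβq, hβm, hu.ne, hu.ne'] <;> norm_num

end Hexagon

end SymmetricHexagon

/-! ### Shadows of the octahedron in terms of the coordinates of the direction -/

section Shadow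

open Module

theorem finrank_shadowPlane {u : E3} (hu : ‖u‖ = 1) : finrank ℝ (shadowPlane u) = 2 := by
  have : Fact (finrank ℝ E3 = 2 + 1) := ⟨by simp⟩
  exact Submodule.finrank_orthogonal_span_singleton (by rintro rfl; simp at hu)

theorem inner_orthogonalProjectionOnto_shadowPlane {u : E3} (hu : ‖u‖ = 1) (v w : E3) :
    inner ℝ ((shadowPlane u).orthogonalProjectionOnto v)
      ((shadowPlane u).orthogonalProjectionOnto w) =
      inner ℝ v w - inner ℝ u v * inner ℝ u w := by
  have h (v : E3) : ((shadowPlane u).orthogonalProjectionOnto v : E3) = v - inner ℝ u v • u := by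
    rw [← Submodule.starProjection_apply, Submodule.starProjection_orthogonal_val,
      Submodule.starProjection_unit_singleton ℝ hu]
  rw [Submodule.coe_inner, h, h]
  simp only [inner_sub_left, inner_sub_right, real_inner_smul_left, real_inner_smul_right,
    real_inner_self_eq_norm_sq, hu, real_inner_comm u]
  ring

theorem linearIndependent_of_gram_ne_zero {V : Type*} [NormedAddCommGroup V]
    [InnerProductSpace ℝ V] {p q : V} (h : ‖p‖ ^ 2 * ‖q‖ ^ 2 - inner ℝ p q ^ 2 ≠ 0) :
    LinearIndependent ℝ ![p, q] := by
  rw [LinearIndependent.pair_iff]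
  intro s t hst
  have h1 : s * ‖p‖ ^ 2 + t * inner ℝ p q = 0 := by
    have := congrArg (inner ℝ p) hst
    simpa [inner_add_right, real_inner_smul_right] using this
  have h2 : s * inner ℝ p q + t * ‖q‖ ^ 2 = 0 := by
    have := congrArg (inner ℝ q) hst
    simpa [inner_add_right, real_inner_smul_right, real_inner_comm p q] using this
  constructor
  · refine (mul_eq_zero.1 (?_ : s * (‖p‖ ^ 2 * ‖q‖ ^ 2 - inner ℝ p q ^ 2) = 0)).resolve_right h
    linear_combination ‖q‖ ^ 2 * h1 - inner ℝ p q * h2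
  · refine (mul_eq_zero.1 (?_ : t * (‖p‖ ^ 2 * ‖q‖ ^ 2 - inner ℝ p q ^ 2) = 0)).resolve_right h
    linear_combination ‖p‖ ^ 2 * h2 - inner ℝ p q * h1

/-- An orthonormal frame on which the vertices of the octahedron lie, and in which the coordinates
of `u` are nonnegative with the last one maximal. -/
structure OctahedralFrame (u : E3) (x y z : ℝ) where
  a : E3
  b : E3
  c : E3
  inner_aa : inner ℝ a a = (1 : ℝ)
  inner_bb : inner ℝ b b = (1 : ℝ)
  inner_cc : inner ℝ c c = (1 : ℝ)
  inner_ab : inner ℝ a b = (0 : ℝ)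
  inner_ac : inner ℝ a c = (0 : ℝ)
  inner_bc : inner ℝ b c = (0 : ℝ)
  vertices : octahedronVertices = {(1 / √2) • a, -((1 / √2) • a), (1 / √2) • b, -((1 / √2) • b),
    -((1 / √2) • c), - -((1 / √2) • c)}
  eq : u = x • a + y • b + z • c
  x_nonneg : 0 ≤ x
  y_nonneg : 0 ≤ y
  x_le : x ≤ z
  y_le : y ≤ z

variable {u : E3} {x y z : ℝ}

theorem OctahedralFrame.inner_u (F : OctahedralFrame u x y z) :
    inner ℝ u F.a = x ∧ inner ℝ u F.b = y ∧ inner ℝ u F.c = z := by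
  refine ⟨(congrArg (inner ℝ · F.a) F.eq).trans ?_, (congrArg (inner ℝ · F.b) F.eq).trans ?_,
    (congrArg (inner ℝ · F.c) F.eq).trans ?_⟩
  all_goals
    simp only [inner_add_left, real_inner_smul_left, F.inner_aa, F.inner_bb, F.inner_cc,
      F.inner_ab, F.inner_ac, F.inner_bc, real_inner_comm F.a F.b, real_inner_comm F.a F.c,
      real_inner_comm F.b F.c]
    ring

theorem OctahedralFrame.sq_add_sq_add_sq (F : OctahedralFrame u x y z) (hu : ‖u‖ = 1) :
    x ^ 2 + y ^ 2 + z ^ 2 = 1 := by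
  have h : inner ℝ u u = (1 : ℝ) := by rw [real_inner_self_eq_norm_sq, hu, one_pow]
  obtain ⟨h1, h2, h3⟩ := F.inner_u
  rw [← h]
  refine Eq.trans ?_ (congrArg (inner ℝ u) F.eq).symm
  simp only [inner_add_right, real_inner_smul_right, h1, h2, h3]
  ring

theorem OctahedralFrame.z_pos (F : OctahedralFrame u x y z) (hu : ‖u‖ = 1) : 0 < z := by
  have := F.sq_add_sq_add_sq hu
  have := F.x_nonneg
  have := F.y_nonneg
  have := F.x_le
  have := F.y_le
  by_contra hz
  have hz0 : z = 0 := by linarith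
  have hx0 : x = 0 := by linarith
  have hy0 : y = 0 := by linarith
  subst hz0 hx0 hy0
  simp_all

/-- The shadow of a vertex direction. -/
noncomputable def shadowVector (u w : E3) : shadowPlane u :=
  (shadowPlane u).orthogonalProjectionOnto ((1 / √2) • w)

theorem inner_shadowVector (hu : ‖u‖ = 1) (v w : E3) :
    inner ℝ (shadowVector u v) (shadowVector u w) =
      1 / 2 * (inner ℝ v w - inner ℝ u v * inner ℝ u w) := by
  rw [shadowVector, shadowVector, inner_orthogonalProjectionOnto_shadowPlane hu]
  simp only [real_inner_smul_left, real_inner_smul_right]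
  have : (1 / √2) * (1 / √2) = 1 / 2 := by
    rw [div_mul_div_comm, Real.mul_self_sqrt (by norm_num)]
    norm_num
  linear_combination (inner ℝ v w - inner ℝ u v * inner ℝ u w) * this

theorem norm_shadowVector (hu : ‖u‖ = 1) (v : E3) :
    ‖shadowVector u v‖ = 1 / √2 * √(inner ℝ v v - inner ℝ u v ^ 2) := by
  rw [norm_eq_sqrt_real_inner, inner_shadowVector hu, Real.sqrt_mul (by norm_num), ← sq,
    Real.sqrt_div zero_le_one, Real.sqrt_one]

theorem shadowVector_add (v w : E3) :
    shadowVector u (v + w) = shadowVector u v + shadowVector u w := by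
  simp [shadowVector]

theorem shadowVector_sub (v w : E3) :
    shadowVector u (v - w) = shadowVector u v - shadowVector u w := by
  simp [shadowVector, smul_sub]

theorem shadowVector_smul (r : ℝ) (v : E3) : shadowVector u (r • v) = r • shadowVector u v := by
  rw [shadowVector, shadowVector, smul_comm, map_smul]

theorem shadowVector_self : shadowVector u u = 0 := by
  rw [shadowVector, map_smul,
    Submodule.orthogonalProjectionOnto_orthogonalComplement_singleton_eq_zero, smul_zero]

theorem two_mul_inv_sqrt_two (t : ℝ) : 2 * (1 / √2 * t) = √2 * t := by
  have : (2 : ℝ) = √2 * √2 := (Real.mul_self_sqrt (by norm_num)).symm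
  rw [← mul_assoc]
  congr 1
  field_simp
  simp

namespace OctahedralFrame

/-- Projection commutes with convex hulls. The frame lists the last pair of vertices as `-c`, `-
-c`, so that the image has the literal form of a hexagon with `m` the shadow of `-c`. -/
theorem octahedronShadow_eq (F : OctahedralFrame u x y z) :
    octahedronShadow u =
      symmetricHexagon (shadowVector u F.a) (shadowVector u F.b) (-shadowVector u F.c) := by
  have h := LinearMap.image_convexHull (𝕜 := ℝ)
    ((shadowPlane u).orthogonalProjectionOnto : E3 →ₗ[ℝ] shadowPlane u) octahedronVertices
  rw [F.vertices] at h
  simp only [Set.image_insert_eq, Set.image_singleton, map_neg] at h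
  rw [octahedronShadow, octahedron, F.vertices]
  exact h

/-- The direction `u = x a + y b + z c` has shadow zero. The negative of `c` is used to make both
coefficients nonnegative. -/
theorem neg_shadowVector_c (F : OctahedralFrame u x y z) (hu : ‖u‖ = 1) :
    -shadowVector u F.c = (x / z) • shadowVector u F.a + (y / z) • shadowVector u F.b := by
  have hz := F.z_pos hu
  have h : shadowVector u (x • F.a + y • F.b + z • F.c) = 0 := by
    rw [← F.eq, shadowVector_self]
  simp only [shadowVector_add, shadowVector_smul] at h
  have h2 : shadowVector u F.c = (1 / z) • (z • shadowVector u F.c) := by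
    rw [smul_smul, one_div_mul_cancel hz.ne', one_smul]
  rw [h2, eq_neg_of_add_eq_zero_right h]
  module

/-- The left side is `((1 - x²)(1 - y²) - x² y²) / 4 = (1 - x² - y²) / 4`, and `u` is a unit vector.
-/
theorem gram_eq (F : OctahedralFrame u x y z) (hu : ‖u‖ = 1) :
    ‖shadowVector u F.a‖ ^ 2 * ‖shadowVector u F.b‖ ^ 2 -
      inner ℝ (shadowVector u F.a) (shadowVector u F.b) ^ 2 = (z / 2) ^ 2 := by
  obtain ⟨h1, h2, h3⟩ := F.inner_u
  simp only [← real_inner_self_eq_norm_sq, inner_shadowVector hu, F.inner_aa, F.inner_bb,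
    F.inner_ab, h1, h2]
  linear_combination (-1 / 4 : ℝ) * F.sq_add_sq_add_sq hu

theorem linearIndependent (F : OctahedralFrame u x y z) (hu : ‖u‖ = 1) :
    LinearIndependent ℝ ![shadowVector u F.a, shadowVector u F.b] := by
  apply linearIndependent_of_gram_ne_zero
  rw [F.gram_eq hu]
  have := F.z_pos hu
  positivity

theorem dist_eq (F : OctahedralFrame u x y z) (hu : ‖u‖ = 1) :
    dist (shadowVector u F.a) (shadowVector u F.b) = 1 / √2 * √(2 - (x - y) ^ 2) ∧
    dist (shadowVector u F.a) (-shadowVector u F.b) = 1 / √2 * √(2 - (x + y) ^ 2) ∧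
    dist (shadowVector u F.a) (-shadowVector u F.c) = 1 / √2 * √(2 - (x + z) ^ 2) ∧
    dist (-shadowVector u F.c) (shadowVector u F.b) = 1 / √2 * √(2 - (y + z) ^ 2) := by
  obtain ⟨h1, h2, h3⟩ := F.inner_u
  rw [dist_comm (-shadowVector u F.c)]
  simp only [dist_eq_norm, sub_neg_eq_add, ← shadowVector_sub, ← shadowVector_add,
    norm_shadowVector hu, inner_add_left, inner_add_right, inner_sub_left, inner_sub_right,
    F.inner_aa, F.inner_bb, F.inner_cc, F.inner_ab, F.inner_ac, F.inner_bc,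
    real_inner_comm F.a F.b, real_inner_comm F.a F.c, real_inner_comm F.b F.c, h1, h2, h3]
  norm_num

theorem shadow_of_add_le (F : OctahedralFrame u x y z) (hu : ‖u‖ = 1)
    (h : x + y ≤ z) :
    chorowidth u = z ∧ periwidth u = √2 * (√(2 - (x - y) ^ 2) + √(2 - (x + y) ^ 2)) ∧
      shadowVertexCount u = 4 := by
  have hz := F.z_pos hu
  have hV := finrank_shadowPlane hu
  have hl : 0 ≤ x / z := div_nonneg F.x_nonneg hz.le
  have hm : 0 ≤ y / z := div_nonneg F.y_nonneg hz.le
  have hlm : x / z + y / z ≤ 1 := by rwa [← add_div, div_le_one hz]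
  have hli := F.linearIndependent hu
  have hc := F.neg_shadowVector_c hu
  refine ⟨?_, ?_, ?_⟩
  · rw [chorowidth, F.octahedronShadow_eq, volume_symmetricHexagon_of_le hV hli hc hl hm hlm,
      F.gram_eq hu, Real.sqrt_sq (by positivity)]
    ring
  · rw [periwidth, F.octahedronShadow_eq,
      hausdorffMeasure_frontier_symmetricHexagon_of_le hV hli hc hl hm hlm, (F.dist_eq hu).1,
      (F.dist_eq hu).2.1, ← mul_add, two_mul_inv_sqrt_two]
  · rw [shadowVertexCount, F.octahedronShadow_eq,
      ncard_extremePoints_symmetricHexagon_of_le hV hli hc hl hm hlm]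

theorem shadow_of_lt_add (F : OctahedralFrame u x y z) (hu : ‖u‖ = 1)
    (h : z < x + y) :
    chorowidth u = 1 / 2 * (x + y + z) ∧
      periwidth u = √2 * (√(2 - (x + y) ^ 2) + √(2 - (x + z) ^ 2) + √(2 - (y + z) ^ 2)) ∧
      shadowVertexCount u = 6 := by
  have hz := F.z_pos hu
  have hV := finrank_shadowPlane hu
  have hl : 0 < x / z := div_pos (by linarith [F.y_le]) hz
  have hm : 0 < y / z := div_pos (by linarith [F.x_le]) hz
  have hl1 : x / z ≤ 1 := (div_le_one hz).2 F.x_le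
  have hm1 : y / z ≤ 1 := (div_le_one hz).2 F.y_le
  have hlm : 1 < x / z + y / z := by rwa [← add_div, one_lt_div hz]
  have hli := F.linearIndependent hu
  have hc := F.neg_shadowVector_c hu
  refine ⟨?_, ?_, ?_⟩
  · rw [chorowidth, F.octahedronShadow_eq, volume_symmetricHexagon hV hli hc hl hm hl1 hm1 hlm,
      F.gram_eq hu, Real.sqrt_sq (by positivity)]
    field_simp
    ring
  · have h4 : dist (shadowVector u F.b) (-shadowVector u F.a) = 1 / √2 * √(2 - (x + y) ^ 2) := by
      rw [← (F.dist_eq hu).2.1, dist_eq_norm, dist_eq_norm, sub_neg_eq_add, sub_neg_eq_add,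
        add_comm]
    rw [periwidth, F.octahedronShadow_eq,
      hausdorffMeasure_frontier_symmetricHexagon hV hli hc hl hm hl1 hm1 hlm,
      (F.dist_eq hu).2.2.1, (F.dist_eq hu).2.2.2, h4, ← mul_add, ← mul_add, two_mul_inv_sqrt_two]
    ring
  · rw [shadowVertexCount, F.octahedronShadow_eq,
      ncard_extremePoints_symmetricHexagon hV hli hc hl hm hl1 hm1 hlm]

end OctahedralFrame

/-- The sign of a real number, with value `1` at `0`. -/
noncomputable def unitSign (t : ℝ) : ℝ := if t < 0 then -1 else 1

theorem unitSign_mul_self (t : ℝ) : unitSign t * unitSign t = 1 := by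
  unfold unitSign
  split_ifs <;> norm_num

theorem abs_mul_unitSign (t : ℝ) : |t| * unitSign t = t := by
  unfold unitSign
  split_ifs with h
  · rw [abs_of_neg h]
    ring
  · rw [abs_of_nonneg (not_lt.1 h), mul_one]

/-- The frame given by the coordinate axes, taken in the order `i`, `j`, `k` and directed so that
`u` has nonnegative coordinates. -/
noncomputable def coordinateFrame (u : E3) {i j k : Fin 3} (hij : i ≠ j) (hik : i ≠ k) (hjk : j ≠ k)
    (hi : |u i| ≤ |u k|) (hj : |u j| ≤ |u k|) :
    OctahedralFrame u |u i| |u j| |u k| where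
  a := EuclideanSpace.single i (unitSign (u i))
  b := EuclideanSpace.single j (unitSign (u j))
  c := EuclideanSpace.single k (unitSign (u k))
  inner_aa := by rw [EuclideanSpace.inner_single_left]; simp [unitSign_mul_self]
  inner_bb := by rw [EuclideanSpace.inner_single_left]; simp [unitSign_mul_self]
  inner_cc := by rw [EuclideanSpace.inner_single_left]; simp [unitSign_mul_self]
  inner_ab := by simp [EuclideanSpace.inner_single_left, hij]
  inner_ac := by simp [EuclideanSpace.inner_single_left, hik]
  inner_bc := by simp [EuclideanSpace.inner_single_left, hjk]
  vertices := by
    have hn : ∀ n : Fin 3, n = i ∨ n = j ∨ n = k := by omega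
    have key : ∀ (n : Fin 3) (t : ℝ) (v : E3), (v = EuclideanSpace.single n (1 / √2) ∨
        v = EuclideanSpace.single n (-(1 / √2))) ↔
        (v = (1 / √2) • EuclideanSpace.single n (unitSign t) ∨
          v = -((1 / √2) • EuclideanSpace.single n (unitSign t))) := by
      intro n t v
      have h1 : (1 / √2) • EuclideanSpace.single n (unitSign t) =
          EuclideanSpace.single n (1 / √2 * unitSign t) := by
        ext m
        by_cases h : m = n <;> simp [h]
      have h2 : -((1 / √2) • EuclideanSpace.single n (unitSign t)) =
          EuclideanSpace.single n (-(1 / √2 * unitSign t)) := by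
        rw [h1]
        ext m
        by_cases h : m = n <;> simp [h]
      rw [h2, h1]
      unfold unitSign
      split_ifs
      · rw [mul_neg, mul_one, neg_neg]
        exact or_comm
      · rw [mul_one]
    ext v
    simp only [octahedronVertices, Set.mem_ofPred_eq, Set.mem_insert_iff, Set.mem_singleton_iff]
    constructor
    · rintro ⟨n, hv⟩
      rcases hn n with rfl | rfl | rfl
      · have := (key n (u n) v).1 hv
        tauto
      · have := (key n (u n) v).1 hv
        tauto
      · have := (key n (u n) v).1 hv
        rw [neg_neg]
        tauto
    · rw [neg_neg]
      intro h
      have : (∃ n, v = (1 / √2) • EuclideanSpace.single n (unitSign (u n)) ∨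
          v = -((1 / √2) • EuclideanSpace.single n (unitSign (u n)))) := by
        rcases h with h | h | h | h | h | h
        exacts [⟨i, Or.inl h⟩, ⟨i, Or.inr h⟩, ⟨j, Or.inl h⟩, ⟨j, Or.inr h⟩, ⟨k, Or.inr h⟩,
          ⟨k, Or.inl h⟩]
      obtain ⟨n, hn⟩ := this
      exact ⟨n, (key n (u n) v).2 hn⟩
  eq := by
    have hn : ∀ n : Fin 3, n = i ∨ n = j ∨ n = k := by omega
    ext n
    rcases hn n with rfl | rfl | rfl
    · simp [abs_mul_unitSign, hij, hik]
    · simp [abs_mul_unitSign, hij.symm, hjk]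
    · simp [abs_mul_unitSign, hik.symm, hjk.symm]
  x_nonneg := abs_nonneg _
  y_nonneg := abs_nonneg _
  x_le := hi
  y_le := hj

theorem shadow_of_abs_add_abs_le (hu : ‖u‖ = 1) {i j k : Fin 3} (hij : i ≠ j) (hik : i ≠ k)
    (hjk : j ≠ k) (h : |u i| + |u j| ≤ |u k|) :
    chorowidth u = |u k| ∧
      periwidth u = √2 * (√(2 - (|u i| - |u j|) ^ 2) + √(2 - (|u i| + |u j|) ^ 2)) ∧
      shadowVertexCount u = 4 :=
  (coordinateFrame u hij hik hjk (by linarith [abs_nonneg (u j)])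
    (by linarith [abs_nonneg (u i)])).shadow_of_add_le hu h

/-- The frame needs a coordinate of largest modulus in last place; the formulas are symmetric, so
the cases differ only in the order of summands. -/
theorem shadow_of_abs_lt_abs_add_abs (hu : ‖u‖ = 1) (h0 : |u 0| < |u 1| + |u 2|)
    (h1 : |u 1| < |u 0| + |u 2|) (h2 : |u 2| < |u 0| + |u 1|) :
    chorowidth u = 1 / 2 * (|u 0| + |u 1| + |u 2|) ∧
      periwidth u = √2 * (√(2 - (|u 0| + |u 1|) ^ 2) + √(2 - (|u 0| + |u 2|) ^ 2) +
        √(2 - (|u 1| + |u 2|) ^ 2)) ∧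
      shadowVertexCount u = 6 := by
  by_cases h02 : |u 0| ≤ |u 2|
  · by_cases h12 : |u 1| ≤ |u 2|
    · exact (coordinateFrame u (i := 0) (j := 1) (k := 2) (by decide) (by decide) (by decide) h02
        h12).shadow_of_lt_add hu h2
    · obtain ⟨e1, e2, e3⟩ := (coordinateFrame u (i := 0) (j := 2) (k := 1) (by decide) (by decide)
        (by decide) (by linarith) (by linarith)).shadow_of_lt_add hu h1
      refine ⟨by rw [e1]; ring, ?_, e3⟩
      rw [e2, add_comm |u 2| |u 1|]
      ring
  · by_cases h12 : |u 1| ≤ |u 0|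
    · obtain ⟨e1, e2, e3⟩ := (coordinateFrame u (i := 1) (j := 2) (k := 0) (by decide) (by decide)
        (by decide) (by linarith) (by linarith)).shadow_of_lt_add hu h0
      refine ⟨by rw [e1]; ring, ?_, e3⟩
      rw [e2, add_comm |u 1| |u 0|, add_comm |u 2| |u 0|]
      ring
    · obtain ⟨e1, e2, e3⟩ := (coordinateFrame u (i := 0) (j := 2) (k := 1) (by decide) (by decide)
        (by decide) (by linarith) (by linarith)).shadow_of_lt_add hu h1
      refine ⟨by rw [e1]; ring, ?_, e3⟩
      rw [e2, add_comm |u 2| |u 1|]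
      ring

end Shadow

/-! ### Spherical coordinates and the three regions of the hexadecant -/

section Hexadecant

open Real

theorem le_arccos_iff {a w : ℝ} (ha : 0 ≤ a) (ha' : a ≤ π) (hw : -1 ≤ w) (hw' : w ≤ 1) :
    a ≤ arccos w ↔ w ≤ cos a := by
  constructor
  · intro h
    rw [← cos_arccos hw hw']
    exact cos_le_cos_of_nonneg_of_le_pi ha (arccos_le_pi w) h
  · intro h
    rw [← arccos_cos ha ha']
    exact arccos_le_arccos h

theorem arccos_le_iff_cos_le {a w : ℝ} (ha : 0 ≤ a) (ha' : a ≤ π) (hw : -1 ≤ w) (hw' : w ≤ 1) :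
    arccos w ≤ a ↔ cos a ≤ w := by
  constructor
  · intro h
    rw [← cos_arccos hw hw']
    exact cos_le_cos_of_nonneg_of_le_pi (arccos_nonneg w) ha' h
  · intro h
    rw [← arccos_cos ha ha']
    exact arccos_le_arccos h

/-- For `φ > 0` the condition compares `cot φ` with `√2`, since `arctan (cot φ) = π / 2 - φ`; the
point `φ = 0` is settled directly. -/
theorem deltaAngle_le_iff {φ : ℝ} (h0 : 0 ≤ φ) (h1 : φ ≤ π / 2) :
    deltaAngle ≤ φ ↔ cos φ ≤ √2 * sin φ := by
  rcases h0.eq_or_lt with rfl | h0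
  · simp only [cos_zero, sin_zero, mul_zero]
    refine iff_of_false ?_ (by norm_num)
    have := arctan_lt_pi_div_two √2
    rw [not_le, deltaAngle, arccot]
    linarith
  · have hs : 0 < sin φ := sin_pos_of_pos_of_lt_pi h0 (by linarith [pi_pos])
    have e : arctan (cos φ / sin φ) = π / 2 - φ := by
      rw [← inv_div, ← tan_eq_sin_div_cos, ← tan_pi_div_two_sub, arctan_tan] <;> linarith
    rw [← div_le_iff₀ hs, ← arctan_le_arctan_iff (x := cos φ / sin φ), e, deltaAngle, arccot]
    constructor <;> intro h <;> linarith

theorem pi_div_four_le_iff {φ : ℝ} (h0 : 0 ≤ φ) (h1 : φ ≤ π / 2) :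
    π / 4 ≤ φ ↔ cos φ ≤ sin φ := by
  have e : cos (π / 4) = sin (π / 4) := by rw [cos_pi_div_four, sin_pi_div_four]
  constructor
  · intro h
    have h2 := cos_le_cos_of_nonneg_of_le_pi (by positivity) (by linarith) h
    have h3 := sin_le_sin_of_le_of_le_pi_div_two (by linarith) h1 h
    linarith
  · intro h
    by_contra hlt
    push Not at hlt
    have h2 := cos_lt_cos_of_nonneg_of_le_pi h0 (by linarith) hlt
    have h3 := sin_lt_sin_of_lt_of_le_pi_div_two (by linarith) (by linarith) hlt
    linarith

/-- This also holds where `cos φ = 0`: both sides are 0 there, the left one by the conventions for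
division by zero. So `φ = π / 2` needs no separate treatment. -/
theorem one_div_sqrt_two_mul_tan (φ : ℝ) : 1 / (√2 * tan φ) = cos φ / (√2 * sin φ) := by
  rw [tan_eq_sin_div_cos, ← mul_div_assoc, one_div, inv_div]

section Bounds

variable {θ φ : ℝ} (hθ : 0 ≤ θ) (hθ' : θ ≤ π / 4) (hφ : 0 ≤ φ) (hφ' : φ ≤ π / 2)
  (hδ : deltaAngle ≤ φ)

include hφ hφ' hδ

theorem sin_pos_of_deltaAngle_le : 0 < sin φ := by
  have h := (deltaAngle_le_iff hφ hφ').1 hδ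
  have h2 : 0 ≤ sin φ := sin_nonneg_of_nonneg_of_le_pi hφ (by linarith)
  refine h2.lt_of_ne fun h0 => ?_
  rw [← h0, mul_zero] at h
  have h3 : 0 ≤ cos φ := cos_nonneg_of_neg_pi_div_two_le_of_le (by linarith) hφ'
  have := sin_sq_add_cos_sq φ
  rw [← h0, le_antisymm h h3] at this
  norm_num at this

theorem cos_div_mem : -1 ≤ cos φ / (√2 * sin φ) ∧ cos φ / (√2 * sin φ) ≤ 1 := by
  have hs := sin_pos_of_deltaAngle_le hφ hφ' hδ
  have h3 : 0 ≤ cos φ := cos_nonneg_of_neg_pi_div_two_le_of_le (by linarith) hφ'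
  refine ⟨le_trans (by norm_num) (div_nonneg h3 (by positivity)), ?_⟩
  rw [div_le_one (by positivity)]
  exact (deltaAngle_le_iff hφ hφ').1 hδ

include hθ hθ'

/-- Since `cos θ + sin θ = √2 cos (π / 4 - θ)`, comparing `θ` with `α` is comparing `x + y` with
`z`. For `β` the same role is played by `cos θ - sin θ = √2 cos (θ + π / 4)`, comparing `x - y` with
`z`. -/
theorem alphaAngle_le_iff :
    (alphaAngle φ ≤ θ ↔ cos φ ≤ cos θ * sin φ + sin θ * sin φ) ∧
      (θ ≤ alphaAngle φ ↔ cos θ * sin φ + sin θ * sin φ ≤ cos φ) := by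
  have hs := sin_pos_of_deltaAngle_le hφ hφ' hδ
  have h2 : √2 * √2 = 2 := mul_self_sqrt (by norm_num)
  obtain ⟨hw, hw'⟩ := cos_div_mem hφ hφ' hδ
  have e : cos (π / 4 - θ) * (√2 * sin φ) = cos θ * sin φ + sin θ * sin φ := by
    rw [cos_sub, cos_pi_div_four, sin_pi_div_four]
    linear_combination (1 / 2) * (cos θ * sin φ + sin θ * sin φ) * h2
  rw [alphaAngle, if_pos hδ, arcsec, one_div_sqrt_two_mul_tan]
  constructor
  · rw [sub_le_comm, le_arccos_iff (by linarith) (by linarith) hw hw', div_le_iff₀ (by positivity),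
      e]
  · rw [le_sub_comm, arccos_le_iff_cos_le (by linarith) (by linarith) hw hw',
      le_div_iff₀ (by positivity), e]

theorem betaAngle_le_iff :
    (betaAngle φ ≤ θ ↔ cos θ * sin φ - sin θ * sin φ ≤ cos φ) ∧
      (θ ≤ betaAngle φ ↔ cos φ ≤ cos θ * sin φ - sin θ * sin φ) := by
  have hs := sin_pos_of_deltaAngle_le hφ hφ' hδ
  have h2 : √2 * √2 = 2 := mul_self_sqrt (by norm_num)
  obtain ⟨hw, hw'⟩ := cos_div_mem hφ hφ' hδ
  have e : cos (θ + π / 4) * (√2 * sin φ) = cos θ * sin φ - sin θ * sin φ := by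
    rw [cos_add, cos_pi_div_four, sin_pi_div_four]
    linear_combination (1 / 2) * (cos θ * sin φ - sin θ * sin φ) * h2
  rw [betaAngle, alphaAngle, if_pos hδ, arcsec, one_div_sqrt_two_mul_tan, neg_sub]
  constructor
  · rw [sub_le_iff_le_add, arccos_le_iff_cos_le (by linarith) (by linarith) hw hw',
      le_div_iff₀ (by positivity), e]
  · rw [le_sub_iff_add_le, le_arccos_iff (by linarith) (by linarith) hw hw',
      div_le_iff₀ (by positivity), e]

end Bounds

/-- On the boundary of the hexagonal region the expressions for the circumference agree. -/
theorem sqrt_add_sqrt_of_eq_add {a b c : ℝ} (ha : 0 ≤ a) (hb : 0 ≤ b) (hc : c = a + b)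
    (h : a ^ 2 + b ^ 2 + c ^ 2 = 1) :
    √(2 - (a - b) ^ 2) = √(2 - (a + c) ^ 2) + √(2 - (b + c) ^ 2) := by
  -- With `c = a + b` the normalization reads `2 = 4 (a² + a b + b²)`, so each radicand is three
  -- times a square.
  have e1 : 2 - (a - b) ^ 2 = (√3 * c) ^ 2 := by
    rw [mul_pow, sq_sqrt (by norm_num)]
    subst hc
    linear_combination -2 * h
  have e2 : 2 - (a + c) ^ 2 = (√3 * b) ^ 2 := by
    rw [mul_pow, sq_sqrt (by norm_num)]
    subst hc
    linear_combination -2 * h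
  have e3 : 2 - (b + c) ^ 2 = (√3 * a) ^ 2 := by
    rw [mul_pow, sq_sqrt (by norm_num)]
    subst hc
    linear_combination -2 * h
  rw [e1, e2, e3, sqrt_sq (by subst hc; positivity), sqrt_sq (by positivity),
    sqrt_sq (by positivity), hc]
  ring

theorem shadow_on_hexadecant (θ φ x y z : ℝ) (hθ : 0 ≤ θ) (hθ' : θ ≤ π / 4) (hφ : 0 ≤ φ)
    (hφ' : φ ≤ π / 2) (hx : x = cos θ * sin φ) (hy : y = sin θ * sin φ) (hz : z = cos φ) :
    ((deltaAngle ≤ φ ∧ max (alphaAngle φ) (betaAngle φ) ≤ θ) ∨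
        (π / 4 ≤ φ ∧ θ ≤ betaAngle φ) ∨
        (φ ≤ π / 4 ∧ θ ≤ alphaAngle φ)) ∧
      (deltaAngle ≤ φ → max (alphaAngle φ) (betaAngle φ) ≤ θ →
        chorowidth (sphericalPoint θ φ) = 1 / 2 * (x + y + z) ∧
        periwidth (sphericalPoint θ φ)
          = √2 * (√(2 - (x + y) ^ 2) + √(2 - (x + z) ^ 2) + √(2 - (y + z) ^ 2))) ∧
      (π / 4 ≤ φ → θ ≤ betaAngle φ →
        chorowidth (sphericalPoint θ φ) = x ∧
        periwidth (sphericalPoint θ φ)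
          = √2 * (√(2 - (y - z) ^ 2) + √(2 - (y + z) ^ 2))) ∧
      (φ ≤ π / 4 → θ ≤ alphaAngle φ →
        chorowidth (sphericalPoint θ φ) = z ∧
        periwidth (sphericalPoint θ φ)
          = √2 * (√(2 - (x - y) ^ 2) + √(2 - (x + y) ^ 2))) := by
  have hsφ : 0 ≤ sin φ := sin_nonneg_of_nonneg_of_le_pi hφ (by linarith)
  have hcφ : 0 ≤ cos φ := cos_nonneg_of_neg_pi_div_two_le_of_le (by linarith) hφ'
  have hsθ : 0 ≤ sin θ := sin_nonneg_of_nonneg_of_le_pi hθ (by linarith)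
  have hcθ : 0 ≤ cos θ := cos_nonneg_of_neg_pi_div_two_le_of_le (by linarith) (by linarith)
  have hx0 : 0 ≤ x := hx ▸ mul_nonneg hcθ hsφ
  have hy0 : 0 ≤ y := hy ▸ mul_nonneg hsθ hsφ
  have hz0 : 0 ≤ z := hz ▸ hcφ
  have hsum : x ^ 2 + y ^ 2 + z ^ 2 = 1 := by
    rw [hx, hy, hz]
    linear_combination sin φ ^ 2 * sin_sq_add_cos_sq θ + sin_sq_add_cos_sq φ
  have hyx : y ≤ x := by
    rw [hx, hy]
    refine mul_le_mul_of_nonneg_right ?_ hsφ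
    by_contra hlt
    exact hlt (by
      have := (pi_div_four_le_iff hθ (by linarith)).not
      rcases hθ'.eq_or_lt with h | h
      · rw [h, sin_pi_div_four, cos_pi_div_four]
      · exact (not_le.1 (this.1 (not_le.2 h))).le)
  have hxs : x ≤ sin φ := by
    rw [hx]
    exact mul_le_of_le_one_left hsφ (cos_le_one θ)
  have hsx : sin φ ≤ x + y := by
    have h1 : 1 ≤ (cos θ + sin θ) ^ 2 := by nlinarith [sin_sq_add_cos_sq θ]
    have h2 : 1 ≤ cos θ + sin θ := by
      by_contra h
      push Not at h
      nlinarith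
    rw [hx, hy]
    nlinarith
  have hxy : x + y ≤ √2 * sin φ := by
    have h1 : cos θ + sin θ ≤ √2 := by
      apply le_sqrt_of_sq_le
      nlinarith [sin_sq_add_cos_sq θ, sq_nonneg (cos θ - sin θ)]
    rw [hx, hy]
    nlinarith
  have hu : ‖sphericalPoint θ φ‖ = 1 := by
    rw [EuclideanSpace.norm_eq, sqrt_eq_one]
    simp only [sphericalPoint, Fin.sum_univ_three, norm_eq_abs, sq_abs]
    simp [← hx, ← hy, ← hz, hsum]
  have c0 : |sphericalPoint θ φ 0| = x := by
    simp [sphericalPoint, ← hx, abs_of_nonneg hx0]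
  have c1 : |sphericalPoint θ φ 1| = y := by
    simp [sphericalPoint, ← hy, abs_of_nonneg hy0]
  have c2 : |sphericalPoint θ φ 2| = z := by
    simp [sphericalPoint, ← hz, abs_of_nonneg hz0]
  have hδ := deltaAngle_le_iff hφ hφ'
  have hα (h : deltaAngle ≤ φ) := alphaAngle_le_iff hθ hθ' hφ hφ' h
  have hβ (h : deltaAngle ≤ φ) := betaAngle_le_iff hθ hθ' hφ hφ' h
  have hq := pi_div_four_le_iff hφ hφ'
  have hδq : π / 4 ≤ φ → deltaAngle ≤ φ := by
    intro h
    have h1 : (1 : ℝ) ≤ √2 := one_le_sqrt.2 (by norm_num)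
    rw [hδ]
    nlinarith [hq.1 h]
  simp only [← hx, ← hy, ← hz] at hα hβ hδ hq
  have k0 := shadow_of_abs_add_abs_le hu (i := 1) (j := 2) (k := 0) (by decide) (by decide)
    (by decide)
  have k2 := shadow_of_abs_add_abs_le hu (i := 0) (j := 1) (k := 2) (by decide) (by decide)
    (by decide)
  have kh := shadow_of_abs_lt_abs_add_abs hu
  rw [c0, c1, c2] at k0 k2 kh
  refine ⟨?_, fun h1 h2 => ?_, fun h1 h2 => ?_, fun h1 h2 => ?_⟩
  · by_cases h : deltaAngle ≤ φ
    · by_cases ha : alphaAngle φ ≤ θ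
      · by_cases hb : betaAngle φ ≤ θ
        · exact Or.inl ⟨h, max_le ha hb⟩
        -- Here `z < x - y ≤ x ≤ sin φ`, which forces `π / 4 ≤ φ`.
        · refine Or.inr (Or.inl ⟨hq.2 ?_, (not_le.1 hb).le⟩)
          rw [(hβ h).1] at hb
          linarith
      · refine Or.inr (Or.inr ⟨?_, (not_le.1 ha).le⟩)
        rw [(hα h).1] at ha
        -- Beyond `π / 4` one has `z ≤ sin φ ≤ x + y`, against `x + y < z`.
        by_contra hlt
        have := hq.1 (not_le.1 hlt).le
        linarith
    · refine Or.inr (Or.inr ⟨?_, ?_⟩)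
      · by_contra hlt
        exact h (hδq (not_le.1 hlt).le)
      · rwa [alphaAngle, if_neg h]
  · have ha := (hα h1).1.1 ((le_max_left _ _).trans h2)
    have hb := (hβ h1).1.1 ((le_max_right _ _).trans h2)
    -- The region is closed: on its edges `z = x + y` and `x = y + z` the shadow is a parallelogram,
    -- and `sqrt_add_sqrt_of_eq_add` shows that the hexagon formula still gives its circumference.
    rcases ha.eq_or_lt with ha | ha
    · obtain ⟨e1, e2, -⟩ := k2 ha.ge
      refine ⟨by rw [e1]; linarith, ?_⟩
      rw [e2, sqrt_add_sqrt_of_eq_add hx0 hy0 ha hsum]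
      ring
    · rcases hb.eq_or_lt with hb | hb
      · obtain ⟨e1, e2, -⟩ := k0 (by linarith)
        refine ⟨by rw [e1]; linarith, ?_⟩
        rw [e2, sqrt_add_sqrt_of_eq_add hy0 hz0 (c := x) (by linarith) (by linarith),
          add_comm y x, add_comm z x]
      · obtain ⟨e1, e2, -⟩ := kh (by linarith) (by linarith) ha
        exact ⟨e1, e2⟩
  · obtain ⟨e1, e2, -⟩ := k0 (by linarith [(hβ (hδq h1)).2.1 h2])
    exact ⟨e1, e2⟩
  · have hle : x + y ≤ z := by
      by_cases h : deltaAngle ≤ φ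
      · exact (hα h).2.1 h2
      -- Below `δ` the whole arc qualifies, since `x + y ≤ √2 sin φ < z`.
      · rw [hδ] at h
        linarith
    obtain ⟨e1, e2, -⟩ := k2 hle
    exact ⟨e1, e2⟩

end Hexadecant

/-! ### Spherical means of functions of two orthonormal coordinates -/

section Averages

open Real Set Module Metric

/-- In polar coordinates the integrand splits into a function of the direction and a function of the
radius, with `r ^ k` coming from homogeneity and the remaining power from the Jacobian. The product
formula for Bochner integrals requires no integrability. -/
theorem integral_homogeneous_mul_radial {E : Type*} [NormedAddCommGroup E] [NormedSpace ℝ E]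
    [FiniteDimensional ℝ E] [Nontrivial E] [MeasurableSpace E] [BorelSpace E] (μ : Measure E)
    [μ.IsAddHaarMeasure] (k : ℕ) (f : E → ℝ) (hf : ∀ r : ℝ, 0 < r → ∀ x, f (r • x) = r ^ k * f x)
    (g : ℝ → ℝ) :
    ∫ x, f x * g ‖x‖ ∂μ =
      (∫ u : sphere (0 : E) 1, f u ∂μ.toSphere) *
        ∫ r in Ioi (0 : ℝ), r ^ (finrank ℝ E - 1 + k) * g r :=
  calc
    ∫ x, f x * g ‖x‖ ∂μ = ∫ x : ({(0)}ᶜ : Set E), f x.1 * g ‖x.1‖ ∂(μ.comap (↑)) := by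
      rw [integral_subtype_comap (measurableSet_singleton _).compl fun x ↦ f x * g ‖x‖,
        restrict_compl_singleton]
    _ = ∫ p : sphere (0 : E) 1 × Ioi (0 : ℝ), f p.1 * ((p.2 : ℝ) ^ k * g p.2)
          ∂μ.toSphere.prod (.volumeIoiPow (finrank ℝ E - 1)) := by
      rw [← μ.measurePreserving_homeomorphUnitSphereProd.integral_comp
        (Homeomorph.measurableEmbedding _)]
      refine integral_congr_ae (Filter.Eventually.of_forall fun x => ?_)
      have hx : 0 < ‖(x : E)‖ := norm_pos_iff.2 x.2
      simp only [homeomorphUnitSphereProd_apply_fst_coe, homeomorphUnitSphereProd_apply_snd_coe]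
      rw [← mul_assoc, mul_comm (f (_ • _)), ← hf _ hx, smul_smul, mul_inv_cancel₀ hx.ne', one_smul]
    _ = (∫ u : sphere (0 : E) 1, f u ∂μ.toSphere) *
          ∫ r : Ioi (0 : ℝ), (r : ℝ) ^ k * g r ∂.volumeIoiPow (finrank ℝ E - 1) :=
      integral_prod_mul (fun u : sphere (0 : E) 1 => f u) fun r : Ioi (0 : ℝ) => (r : ℝ) ^ k * g r
    _ = _ := by
      congr 1
      simp only [Measure.volumeIoiPow, ENNReal.ofReal]
      rw [integral_withDensity_eq_integral_smul,
        integral_subtype_comap measurableSet_Ioi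
          fun a ↦ Real.toNNReal (a ^ (finrank ℝ E - 1)) • (a ^ k * g a),
        setIntegral_congr_fun measurableSet_Ioi fun x hx ↦ ?_]
      · rw [NNReal.smul_def, Real.coe_toNNReal _ (pow_nonneg hx.out.le _), smul_eq_mul, pow_add,
          mul_assoc]
      · exact (measurable_subtype_coe.pow_const _).real_toNNReal

theorem integral_homogeneous_mul_exp_plane (k : ℕ) (h : ℝ × ℝ → ℝ)
    (hh : ∀ r : ℝ, 0 < r → ∀ p, h (r • p) = r ^ k * h p) :
    ∫ p : ℝ × ℝ, h p * exp (-(p.1 ^ 2 + p.2 ^ 2)) =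
      (∫ r in Ioi (0 : ℝ), r ^ (k + 1) * exp (-r ^ 2)) *
        ∫ t in Ioo (-π) π, h (cos t, sin t) := by
  rw [← integral_comp_polarCoord_symm, polarCoord_target, ← setIntegral_prod_mul]
  refine setIntegral_congr_fun (measurableSet_Ioi.prod measurableSet_Ioo) ?_
  rintro ⟨r, t⟩ ⟨hr, -⟩
  have e : (r * cos t, r * sin t) = r • (cos t, sin t) := by simp
  simp only [polarCoord_symm_apply, smul_eq_mul]
  rw [e, hh r hr, show (r * cos t) ^ 2 + (r * sin t) ^ 2 = r ^ 2 by
    linear_combination r ^ 2 * sin_sq_add_cos_sq t]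
  ring

theorem integral_plane_mul_exp_pi (h : ℝ × ℝ → ℝ) :
    ∫ x : Fin 3 → ℝ, h (x 0, x 1) * exp (-(x 0 ^ 2 + x 1 ^ 2 + x 2 ^ 2)) =
      √π * ∫ p : ℝ × ℝ, h p * exp (-(p.1 ^ 2 + p.2 ^ 2)) := by
  have e1 := (volume_preserving_piFinSuccAbove (fun _ : Fin 3 => ℝ) 2).integral_comp'
    (fun q : ℝ × (Fin 2 → ℝ) => exp (-1 * q.1 ^ 2) *
      (h (q.2 0, q.2 1) * exp (-(q.2 0 ^ 2 + q.2 1 ^ 2))))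
  have e2 := (volume_preserving_finTwoArrow ℝ).integral_comp'
    (fun p : ℝ × ℝ => h p * exp (-(p.1 ^ 2 + p.2 ^ 2)))
  have e3 := integral_prod_mul (μ := (volume : Measure ℝ)) (ν := (volume : Measure (Fin 2 → ℝ)))
    (fun t : ℝ => exp (-1 * t ^ 2))
    (fun q : Fin 2 → ℝ => h (q 0, q 1) * exp (-(q 0 ^ 2 + q 1 ^ 2)))
  rw [integral_gaussian, div_one] at e3
  rw [← e2]
  refine Eq.trans ?_ (e1.trans e3)
  refine integral_congr_ae (Filter.Eventually.of_forall fun x => ?_)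
  simp only [MeasurableEquiv.piFinSuccAbove_apply]
  have h0 : (2 : Fin 3).succAbove 0 = 0 := rfl
  have h1 : (2 : Fin 3).succAbove 1 = 1 := rfl
  simp only [Fin.insertNthEquiv_symm_apply, Fin.removeNth_apply, h0, h1]
  rw [mul_left_comm, ← exp_add]
  ring_nf

theorem exists_orthonormalBasis_of_pair {v w : E3} (hv : ‖v‖ = 1) (hw : ‖w‖ = 1)
    (hvw : inner ℝ v w = (0 : ℝ)) :
    ∃ b : OrthonormalBasis (Fin 3) ℝ E3, b 0 = v ∧ b 1 = w := by
  have ho : Orthonormal ℝ (({0, 1} : Set (Fin 3)).domRestrict ![v, w, 0]) := by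
    constructor
    · rintro ⟨i, rfl | rfl⟩ <;> simp [Set.domRestrict, hv, hw]
    · rintro ⟨i, rfl | rfl⟩ ⟨j, rfl | rfl⟩ hij <;>
        simp [Set.domRestrict, hvw, real_inner_comm v w] at hij ⊢
  obtain ⟨b, hb⟩ := ho.exists_orthonormalBasis_extension_of_card_eq (by simp)
  exact ⟨b, by simpa using hb 0 (by simp), by simpa using hb 1 (by simp)⟩

/-- Both sides are the integral of `h (⟨v, x⟩, ⟨w, x⟩) exp (-‖x‖²)` over space. The left uses polar
coordinates in space; the right integrates out the third coordinate of an orthonormal basis, giving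
`√π`, and uses polar coordinates in the plane. -/
theorem integral_toSphere_plane {v w : E3} (hv : ‖v‖ = 1) (hw : ‖w‖ = 1)
    (hvw : inner ℝ v w = (0 : ℝ)) (k : ℕ) (h : ℝ × ℝ → ℝ)
    (hh : ∀ r : ℝ, 0 < r → ∀ p, h (r • p) = r ^ k * h p) :
    (∫ u : sphere (0 : E3) 1, h (inner ℝ v (u : E3), inner ℝ w (u : E3))
        ∂(volume : Measure E3).toSphere) *
      (∫ r in Ioi (0 : ℝ), r ^ (k + 2) * exp (-r ^ 2)) =
    √π * ((∫ r in Ioi (0 : ℝ), r ^ (k + 1) * exp (-r ^ 2)) *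
      ∫ t in Ioo (-π) π, h (cos t, sin t)) := by
  obtain ⟨b, rfl, rfl⟩ := exists_orthonormalBasis_of_pair hv hw hvw
  have e1 := integral_homogeneous_mul_radial (volume : Measure E3) k
    (fun x : E3 => h (inner ℝ (b 0) x, inner ℝ (b 1) x))
    (fun r hr x => by
      rw [← hh r hr]
      simp [real_inner_smul_right]) (fun r => exp (-r ^ 2))
  rw [finrank_euclideanSpace_fin, show 3 - 1 + k = k + 2 by omega] at e1
  rw [← e1, ← integral_homogeneous_mul_exp_plane k h hh, ← integral_plane_mul_exp_pi]
  have m1 := b.measurePreserving_measurableEquiv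
  have m2 := EuclideanSpace.volume_preserving_symm_measurableEquiv_toLp (Fin 3)
  symm
  rw [← m2.integral_comp', ← m1.integral_comp']
  refine integral_congr_ae (Filter.Eventually.of_forall fun x => ?_)
  have e2 : ‖x‖ ^ 2 = inner ℝ (b 0) x ^ 2 + inner ℝ (b 1) x ^ 2 + inner ℝ (b 2) x ^ 2 := by
    rw [← b.sum_sq_inner_right x, Fin.sum_univ_three]
  have e3 (i : Fin 3) : inner ℝ (b i) x =
      ((MeasurableEquiv.toLp 2 (Fin 3 → ℝ)).symm (b.measurableEquiv x)) i :=
    (b.repr_apply_apply x i).symm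
  simp only [e2, e3]

theorem integral_pow_mul_exp_neg_sq (n : ℕ) :
    ∫ r in Ioi (0 : ℝ), r ^ n * exp (-r ^ 2) = 1 / 2 * Gamma ((n + 1) / 2) := by
  have h := integral_rpow_mul_exp_neg_rpow (p := 2) (q := n) (by norm_num)
    (by linarith [(Nat.cast_nonneg n : (0 : ℝ) ≤ n)])
  rw [← h]
  refine setIntegral_congr_fun measurableSet_Ioi fun r _ => ?_
  simp only [rpow_natCast, rpow_two]

theorem toSphere_real_univ : (volume : Measure E3).toSphere.real univ = 4 * π := by
  rw [Measure.toSphere_real_apply_univ, measureReal_def, EuclideanSpace.volume_ball_fin_three]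
  rw [ENNReal.toReal_mul, ENNReal.toReal_ofReal (by positivity)]
  simp
  ring

theorem integral_sphereUniform (f : sphere (0 : E3) 1 → ℝ) :
    ∫ u, f u ∂sphereUniform = 1 / (4 * π) * ∫ u, f u ∂(volume : Measure E3).toSphere := by
  rw [sphereUniform, integral_smul_measure, ENNReal.toReal_inv, ← measureReal_def,
    toSphere_real_univ, smul_eq_mul, one_div]

section Degrees

variable {v w : E3} (hv : ‖v‖ = 1) (hw : ‖w‖ = 1) (hvw : inner ℝ v w = (0 : ℝ)) {h : ℝ × ℝ → ℝ}

include hv hw hvw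

/-- In degree `k` the factor is `√π Γ((k + 2)/2) / (4π Γ((k + 3)/2))`; only degrees 0, 1 and 2
occur, with values `1/(2π)`, `1/8` and `1/(3π)`. -/
theorem average_of_degree_zero (hh : ∀ r : ℝ, 0 < r → ∀ p, h (r • p) = h p) :
    ∫ u : sphere (0 : E3) 1, h (inner ℝ v (u : E3), inner ℝ w (u : E3)) ∂sphereUniform =
      1 / (2 * π) * ∫ t in (-π)..π, h (cos t, sin t) := by
  have e := integral_toSphere_plane hv hw hvw 0 h (by simpa using hh)
  rw [integral_pow_mul_exp_neg_sq, integral_pow_mul_exp_neg_sq] at e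
  have g1 : Gamma ((((0 + 2 : ℕ) : ℝ) + 1) / 2) = √π / 2 := by
    rw [show (((0 + 2 : ℕ) : ℝ) + 1) / 2 = 1 / 2 + 1 by norm_num, Gamma_add_one (by norm_num),
      Gamma_one_half_eq]
    ring
  have g2 : Gamma ((((0 + 1 : ℕ) : ℝ) + 1) / 2) = 1 := by norm_num
  rw [g1, g2] at e
  have hπ : 0 < √π := sqrt_pos.2 pi_pos
  rw [integral_sphereUniform, intervalIntegral.integral_of_le (by linarith [pi_pos]),
    integral_Ioc_eq_integral_Ioo]
  have e2 := mul_left_cancel₀ hπ.ne' ((by linear_combination e :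
    √π * ((∫ u : sphere (0 : E3) 1, h (inner ℝ v (u : E3), inner ℝ w (u : E3))
        ∂(volume : Measure E3).toSphere) * (1 / 4)) =
      √π * ((1 / 2) * ∫ t in Ioo (-π) π, h (cos t, sin t))))
  field_simp
  linear_combination 8 * e2

theorem average_of_degree_one (hh : ∀ r : ℝ, 0 < r → ∀ p, h (r • p) = r * h p) :
    ∫ u : sphere (0 : E3) 1, h (inner ℝ v (u : E3), inner ℝ w (u : E3)) ∂sphereUniform =
      1 / 8 * ∫ t in (-π)..π, h (cos t, sin t) := by
  have e := integral_toSphere_plane hv hw hvw 1 h (by simpa using hh)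
  rw [integral_pow_mul_exp_neg_sq, integral_pow_mul_exp_neg_sq] at e
  have g1 : Gamma ((((1 + 2 : ℕ) : ℝ) + 1) / 2) = 1 := by norm_num
  have g2 : Gamma ((((1 + 1 : ℕ) : ℝ) + 1) / 2) = √π / 2 := by
    rw [show (((1 + 1 : ℕ) : ℝ) + 1) / 2 = 1 / 2 + 1 by norm_num, Gamma_add_one (by norm_num),
      Gamma_one_half_eq]
    ring
  rw [g1, g2] at e
  have hπ : √π * √π = π := mul_self_sqrt pi_pos.le
  rw [integral_sphereUniform, intervalIntegral.integral_of_le (by linarith [pi_pos]),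
    integral_Ioc_eq_integral_Ioo]
  field_simp
  linear_combination 16 * e + 4 * (∫ t in Ioo (-π) π, h (cos t, sin t)) * hπ

theorem average_of_degree_two (hh : ∀ r : ℝ, 0 < r → ∀ p, h (r • p) = r ^ 2 * h p) :
    ∫ u : sphere (0 : E3) 1, h (inner ℝ v (u : E3), inner ℝ w (u : E3)) ∂sphereUniform =
      1 / (3 * π) * ∫ t in (-π)..π, h (cos t, sin t) := by
  have e := integral_toSphere_plane hv hw hvw 2 h hh
  rw [integral_pow_mul_exp_neg_sq, integral_pow_mul_exp_neg_sq] at e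
  have g1 : Gamma ((((2 + 2 : ℕ) : ℝ) + 1) / 2) = 3 / 4 * √π := by
    rw [show (((2 + 2 : ℕ) : ℝ) + 1) / 2 = (1 / 2 + 1) + 1 by norm_num,
      Gamma_add_one (by norm_num), Gamma_add_one (by norm_num), Gamma_one_half_eq]
    ring
  have g2 : Gamma ((((2 + 1 : ℕ) : ℝ) + 1) / 2) = 1 := by norm_num
  rw [g1, g2] at e
  have hπ : 0 < √π := sqrt_pos.2 pi_pos
  rw [integral_sphereUniform, intervalIntegral.integral_of_le (by linarith [pi_pos]),
    integral_Ioc_eq_integral_Ioo]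
  have e2 := mul_left_cancel₀ hπ.ne' ((by linear_combination e :
    √π * ((∫ u : sphere (0 : E3) 1, h (inner ℝ v (u : E3), inner ℝ w (u : E3))
        ∂(volume : Measure E3).toSphere) * (3 / 8)) =
      √π * ((1 / 2) * ∫ t in Ioo (-π) π, h (cos t, sin t))))
  field_simp
  linear_combination 8 * e2

end Degrees

end Averages

/-! ### The integrals over the unit circle -/

section CircleIntegrals

open Real Set

/-- The substitution `s = 2t` covers two periods with weight one half, and evenness of the cosine
folds one period onto `[0, π]`. -/
theorem integral_comp_cos_two_mul (G : ℝ → ℝ)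
    (hG : ∀ a b, IntervalIntegrable (fun s => G (cos s)) volume a b) :
    ∫ t in (-π)..π, G (cos (2 * t)) = 2 * ∫ s in (0)..π, G (cos s) := by
  have hper : Function.Periodic (fun s => G (cos s)) (2 * π) := fun s => by
    simp only [cos_add_two_pi]
  have h1 := intervalIntegral.integral_comp_mul_left (a := -π) (b := π) (fun s => G (cos s))
    (two_ne_zero : (2 : ℝ) ≠ 0)
  have h2 := hper.intervalIntegral_add_eq (-(2 * π)) (-π)
  have h3 := hper.intervalIntegral_add_eq 0 (-π)
  rw [show -(2 * π) + 2 * π = 0 by ring, show -π + 2 * π = π by ring] at h2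
  rw [show (0 : ℝ) + 2 * π = 2 * π by ring, show -π + 2 * π = π by ring] at h3
  have h4 := intervalIntegral.integral_add_adjacent_intervals (hG (-(2 * π)) 0) (hG 0 (2 * π))
  have h5 := intervalIntegral.integral_add_adjacent_intervals (hG (-π) 0) (hG 0 π)
  have h6 := intervalIntegral.integral_comp_neg (a := 0) (b := π) (fun s => G (cos s))
  simp only [cos_neg, neg_zero] at h6
  rw [h1, show (2 : ℝ) * -π = -(2 * π) by ring, smul_eq_mul, ← h4, h2, h3, ← h5, ← h6]
  ring

theorem arcsec_three : cos (arcsec 3) = 1 / 3 ∧ sin (arcsec 3) = 2 * √2 / 3 ∧ 0 ≤ arcsec 3 ∧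
    arcsec 3 ≤ π := by
  refine ⟨cos_arccos (by norm_num) (by norm_num), ?_, arccos_nonneg _, arccos_le_pi _⟩
  rw [arcsec, sin_arccos, show (1 : ℝ) - (1 / 3) ^ 2 = (2 / 3) ^ 2 * 2 by norm_num,
    sqrt_mul (by norm_num), sqrt_sq (by norm_num)]
  ring

theorem cos_lt_neg_third_iff {s : ℝ} (h0 : 0 ≤ s) (h1 : s ≤ π) :
    cos s < -(1 / 3) ↔ π - arcsec 3 < s := by
  obtain ⟨hc, -, h2, h3⟩ := arcsec_three
  have e : cos (π - arcsec 3) = -(1 / 3) := by rw [cos_pi_sub, hc]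
  rw [← e]
  exact strictAntiOn_cos.lt_iff_gt ⟨h0, h1⟩ ⟨by linarith, by linarith⟩

theorem intervalIntegrable_indicator_cos (a b : ℝ) :
    IntervalIntegrable (fun s => if cos s < -(1 / 3) then (1 : ℝ) else 0) volume a b := by
  have : (fun s => if cos s < -(1 / 3) then (1 : ℝ) else 0) =
      {s | cos s < -(1 / 3)}.indicator fun _ => (1 : ℝ) := by
    ext s
    simp [indicator]
  rw [this]
  have hm : MeasurableSet {s : ℝ | cos s < -(1 / 3)} :=
    measurableSet_lt continuous_cos.measurable measurable_const
  exact ⟨intervalIntegrable_const.1.indicator hm, intervalIntegrable_const.2.indicator hm⟩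

/-- The condition is `cos 2t < -1/3`. For `s = 2t` in `[0, π]` this is the interval from `π - arcsec
3` to `π`, of length `arcsec 3`. -/
theorem integral_indicator_circle :
    ∫ t in (-π)..π, (if 2 * cos t ^ 2 < sin t ^ 2 then (1 : ℝ) else 0) = 2 * arcsec 3 := by
  obtain ⟨-, -, h2, h3⟩ := arcsec_three
  have e := integral_comp_cos_two_mul (fun c => if c < -(1 / 3) then (1 : ℝ) else 0)
    intervalIntegrable_indicator_cos
  have e1 : ∀ t : ℝ, (2 * cos t ^ 2 < sin t ^ 2) = (cos (2 * t) < -(1 / 3)) := by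
    intro t
    rw [cos_two_mul, sin_sq]
    exact propext ⟨fun h => by linarith, fun h => by linarith⟩
  simp only [e1]
  rw [e, ← intervalIntegral.integral_add_adjacent_intervals (b := π - arcsec 3)
    (intervalIntegrable_indicator_cos _ _) (intervalIntegrable_indicator_cos _ _)]
  have i1 : ∫ s in (0)..(π - arcsec 3), (if cos s < -(1 / 3) then (1 : ℝ) else 0) =
      ∫ s in (0)..(π - arcsec 3), (0 : ℝ) := by
    refine intervalIntegral.integral_congr_ae (Filter.Eventually.of_forall fun s hs => ?_)
    rw [uIoc_of_le (by linarith)] at hs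
    rw [if_neg]
    rw [cos_lt_neg_third_iff hs.1.le (by linarith [hs.2])]
    exact not_lt.2 hs.2
  have i2 : ∫ s in (π - arcsec 3)..π, (if cos s < -(1 / 3) then (1 : ℝ) else 0) =
      ∫ s in (π - arcsec 3)..π, (1 : ℝ) := by
    refine intervalIntegral.integral_congr_ae (Filter.Eventually.of_forall fun s hs => ?_)
    rw [uIoc_of_le (by linarith)] at hs
    rw [if_pos]
    rw [cos_lt_neg_third_iff (by linarith [hs.1]) hs.2]
    exact hs.1
  rw [i1, i2]
  simp

/-- The integrand is `|1 + 3 cos 2t| / 2`, which changes sign at `2t = π - arcsec 3`; on each piece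
`(s + 3 sin s) / 2` is a primitive up to sign. -/
theorem integral_abs_circle :
    ∫ t in (-π)..π, |2 * cos t ^ 2 - sin t ^ 2| = π - 2 * arcsec 3 + 4 * √2 := by
  obtain ⟨hc, hs, h2, h3⟩ := arcsec_three
  have hcont : Continuous fun s => |1 + 3 * cos s| / 2 := by fun_prop
  have e := integral_comp_cos_two_mul (fun c => |1 + 3 * c| / 2)
    fun a b => hcont.intervalIntegrable a b
  have e1 : ∀ t : ℝ, |2 * cos t ^ 2 - sin t ^ 2| = |1 + 3 * cos (2 * t)| / 2 := by
    intro t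
    rw [cos_two_mul, sin_sq, ← abs_of_pos (two_pos : (0 : ℝ) < 2), ← abs_div]
    congr 1
    rw [abs_of_pos two_pos]
    ring
  simp only [e1]
  rw [e, ← intervalIntegral.integral_add_adjacent_intervals (b := π - arcsec 3)
    (hcont.intervalIntegrable _ _) (hcont.intervalIntegrable _ _)]
  have hd (s : ℝ) : HasDerivAt (fun s => (s + 3 * sin s) / 2) ((1 + 3 * cos s) / 2) s :=
    ((hasDerivAt_id s).add ((hasDerivAt_sin s).const_mul 3)).div_const 2
  have hcont' : Continuous fun s => (1 + 3 * cos s) / 2 := by fun_prop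
  have i1 : ∫ s in (0)..(π - arcsec 3), |1 + 3 * cos s| / 2 =
      ∫ s in (0)..(π - arcsec 3), (1 + 3 * cos s) / 2 := by
    refine intervalIntegral.integral_congr fun s hs => ?_
    rw [uIcc_of_le (by linarith)] at hs
    have := (cos_lt_neg_third_iff hs.1 (by linarith [hs.2])).not.2 (not_lt.2 hs.2)
    rw [abs_of_nonneg (by linarith)]
  have i2 : ∫ s in (π - arcsec 3)..π, |1 + 3 * cos s| / 2 =
      ∫ s in (π - arcsec 3)..π, -((1 + 3 * cos s) / 2) := by
    refine intervalIntegral.integral_congr_ae (Filter.Eventually.of_forall fun s hs => ?_)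
    rw [uIoc_of_le (by linarith)] at hs
    have := (cos_lt_neg_third_iff (by linarith [hs.1]) hs.2).2 hs.1
    rw [abs_of_neg (by linarith)]
    ring
  rw [i1, i2, intervalIntegral.integral_neg,
    intervalIntegral.integral_eq_sub_of_hasDerivAt (fun s _ => hd s)
      (hcont'.intervalIntegrable _ _),
    intervalIntegral.integral_eq_sub_of_hasDerivAt (fun s _ => hd s)
      (hcont'.intervalIntegrable _ _), sin_pi_sub, hs]
  simp only [sin_zero, sin_pi]
  ring

theorem integral_abs_cos_circle : ∫ t in (-π)..π, |cos t| = 4 := by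
  have hper : Function.Periodic (fun s => |cos s|) π := fun s => by
    simp only [cos_add_pi, abs_neg]
  have hcont : Continuous fun s => |cos s| := by fun_prop
  have h1 := hper.intervalIntegral_add_eq (-π) (-(π / 2))
  have h2 := hper.intervalIntegral_add_eq 0 (-(π / 2))
  rw [show -(π / 2) + π = π / 2 by ring] at h1 h2
  rw [neg_add_cancel] at h1
  rw [zero_add] at h2
  have h3 : ∫ s in (-(π / 2))..(π / 2), |cos s| = ∫ s in (-(π / 2))..(π / 2), cos s := by
    refine intervalIntegral.integral_congr fun s hs => ?_
    rw [uIcc_of_le (by linarith [pi_pos])] at hs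
    exact abs_of_nonneg (cos_nonneg_of_mem_Icc hs)
  rw [← intervalIntegral.integral_add_adjacent_intervals (hcont.intervalIntegrable (-π) 0)
    (hcont.intervalIntegrable 0 π), h1, h2, h3, integral_cos]
  simp
  norm_num

end CircleIntegrals

/-! ### Mean contributions of single edges and faces, and null sets of directions -/

section EdgeAverages

open Real Set Metric

/-- The unit vector bisecting the directions `e i` and `± e j`. -/
noncomputable def diagonalVector (i j : Fin 3) (ε : ℝ) : E3 :=
  EuclideanSpace.single i (1 / √2) + EuclideanSpace.single j (ε / √2)

theorem inner_diagonalVector (i j : Fin 3) (ε : ℝ) (u : E3) :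
    inner ℝ (diagonalVector i j ε) u = (u i + ε * u j) / √2 := by
  rw [diagonalVector, inner_add_left, EuclideanSpace.inner_single_left,
    EuclideanSpace.inner_single_left]
  simp
  ring

theorem norm_diagonalVector {i j : Fin 3} (hij : i ≠ j) {ε : ℝ} (hε : ε ^ 2 = 1) :
    ‖diagonalVector i j ε‖ = 1 := by
  have h : inner ℝ (diagonalVector i j ε) (diagonalVector i j ε) = (1 : ℝ) := by
    rw [inner_diagonalVector]
    have h2 : √2 * √2 = 2 := mul_self_sqrt (by norm_num)
    simp [diagonalVector, hij, hij.symm]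
    field_simp
    rw [sq √2, h2, hε]
    norm_num
  rw [real_inner_self_eq_norm_sq] at h
  exact (pow_eq_one_iff_of_nonneg (norm_nonneg _) two_ne_zero).1 h

theorem inner_axis (k : Fin 3) (u : E3) : inner ℝ (EuclideanSpace.single k (1 : ℝ)) u = u k := by
  rw [EuclideanSpace.inner_single_left]
  simp

section

variable {i j k : Fin 3} (hij : i ≠ j) (hik : i ≠ k) (hjk : j ≠ k) {ε : ℝ} (hε : ε ^ 2 = 1)

include hik hjk in
theorem inner_diagonalVector_axis :
    inner ℝ (diagonalVector i j ε) (EuclideanSpace.single k (1 : ℝ)) = (0 : ℝ) := by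
  rw [inner_diagonalVector]
  simp [hik, hjk]

include hij hik hjk in
theorem sum_sq_sphere (u : sphere (0 : E3) 1) :
    (u : E3) i ^ 2 + (u : E3) j ^ 2 + (u : E3) k ^ 2 = 1 := by
  have h : ‖(u : E3)‖ ^ 2 = 1 := by rw [norm_eq_of_mem_sphere, one_pow]
  rw [EuclideanSpace.norm_sq_eq, Fin.sum_univ_three] at h
  simp only [norm_eq_abs, sq_abs] at h
  refine Eq.trans ?_ h
  fin_cases i <;> fin_cases j <;> fin_cases k <;> simp at hij hik hjk ⊢ <;> ring

include hij hik hjk hε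

theorem average_edge_indicator :
    ∫ u : sphere (0 : E3) 1, (if ((u : E3) i + ε * (u : E3) j) ^ 2 < (u : E3) k ^ 2
      then (1 : ℝ) else 0) ∂sphereUniform = arcsec 3 / π := by
  have h2 : √2 ^ 2 = 2 := sq_sqrt (by norm_num)
  have h := average_of_degree_zero (norm_diagonalVector hij hε)
    (by simp : ‖(EuclideanSpace.single k (1 : ℝ) : E3)‖ = 1) (inner_diagonalVector_axis hik hjk)
    (h := fun p => if 2 * p.1 ^ 2 < p.2 ^ 2 then (1 : ℝ) else 0) (fun r hr p => by
      have : (2 * (r • p).1 ^ 2 < (r • p).2 ^ 2) = (2 * p.1 ^ 2 < p.2 ^ 2) := by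
        simp only [Prod.smul_fst, Prod.smul_snd, smul_eq_mul, mul_pow, mul_left_comm (2 : ℝ)]
        exact propext (mul_lt_mul_iff_right₀ (by positivity))
      simp only [this])
  simp only [inner_diagonalVector, inner_axis, div_pow, h2, integral_indicator_circle] at h
  simp only [mul_div_cancel₀ _ (two_ne_zero : (2 : ℝ) ≠ 0)] at h
  rw [h]
  field_simp

/-- The length involves the direction `e i - ε e j`, orthogonal to the plane of the diagonal and the
axis `k`. The equation of the sphere trades it for `2 (p₁² + p₂²)` in coordinates of that plane, so
the term becomes homogeneous of degree one and its length factor is constant on the circle. -/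
theorem average_edge_length :
    ∫ u : sphere (0 : E3) 1, (if ((u : E3) i + ε * (u : E3) j) ^ 2 < (u : E3) k ^ 2
      then √(2 - ((u : E3) i - ε * (u : E3) j) ^ 2) else 0) ∂sphereUniform =
      √2 * arcsec 3 / 4 := by
  have h2 : √2 ^ 2 = 2 := sq_sqrt (by norm_num)
  have h := average_of_degree_one (norm_diagonalVector hij hε)
    (by simp : ‖(EuclideanSpace.single k (1 : ℝ) : E3)‖ = 1) (inner_diagonalVector_axis hik hjk)
    (h := fun p => √2 * (√(p.1 ^ 2 + p.2 ^ 2) * if 2 * p.1 ^ 2 < p.2 ^ 2 then (1 : ℝ) else 0))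
    (fun r hr p => by
      have : (2 * (r • p).1 ^ 2 < (r • p).2 ^ 2) = (2 * p.1 ^ 2 < p.2 ^ 2) := by
        simp only [Prod.smul_fst, Prod.smul_snd, smul_eq_mul, mul_pow, mul_left_comm (2 : ℝ)]
        exact propext (mul_lt_mul_iff_right₀ (by positivity))
      have h3 : √((r • p).1 ^ 2 + (r • p).2 ^ 2) = r * √(p.1 ^ 2 + p.2 ^ 2) := by
        simp only [Prod.smul_fst, Prod.smul_snd, smul_eq_mul, mul_pow, ← mul_add]
        rw [sqrt_mul (sq_nonneg r), sqrt_sq hr.le]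
      simp only [this, h3]
      ring)
  simp only [inner_diagonalVector, inner_axis, div_pow, h2] at h
  simp only [mul_div_cancel₀ _ (two_ne_zero : (2 : ℝ) ≠ 0), cos_sq_add_sin_sq, sqrt_one,
    one_mul, intervalIntegral.integral_const_mul, integral_indicator_circle] at h
  rw [show √2 * arcsec 3 / 4 = 1 / 8 * (√2 * (2 * arcsec 3)) by ring, ← h]
  refine integral_congr_ae (Filter.Eventually.of_forall fun u => ?_)
  simp only
  rw [← mul_assoc, ← sqrt_mul (by norm_num)]
  have e : 2 - ((u : E3) i - ε * (u : E3) j) ^ 2 =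
      2 * (((u : E3) i + ε * (u : E3) j) ^ 2 / 2 + (u : E3) k ^ 2) := by
    linear_combination (-2 : ℝ) * sum_sq_sphere hij hik hjk u - 2 * (u : E3) j ^ 2 * hε
  rw [e, mul_ite, mul_one, mul_zero]

theorem average_edge_product :
    ∫ u : sphere (0 : E3) 1, |((u : E3) i + ε * (u : E3) j) ^ 2 - (u : E3) k ^ 2| ∂sphereUniform =
      1 / (3 * π) * (π - 2 * arcsec 3 + 4 * √2) := by
  have h2 : √2 ^ 2 = 2 := sq_sqrt (by norm_num)
  have h := average_of_degree_two (norm_diagonalVector hij hε)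
    (by simp : ‖(EuclideanSpace.single k (1 : ℝ) : E3)‖ = 1) (inner_diagonalVector_axis hik hjk)
    (h := fun p => |2 * p.1 ^ 2 - p.2 ^ 2|) (fun r hr p => by
      simp only [Prod.smul_fst, Prod.smul_snd, smul_eq_mul, mul_pow]
      rw [mul_left_comm, ← mul_sub, abs_mul, abs_of_nonneg (sq_nonneg r)])
  simp only [inner_diagonalVector, inner_axis, div_pow, h2, integral_abs_circle] at h
  simp only [mul_div_cancel₀ _ (two_ne_zero : (2 : ℝ) ≠ 0)] at h
  exact h

end

theorem average_abs_inner {v w : E3} (hv : ‖v‖ = 1) (hw : ‖w‖ = 1)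
    (hvw : inner ℝ v w = (0 : ℝ)) :
    ∫ u : sphere (0 : E3) 1, |inner ℝ v (u : E3)| ∂sphereUniform = 1 / 2 := by
  have h := average_of_degree_one hv hw hvw (h := fun p => |p.1|) (fun r hr p => by
    simp [abs_mul, abs_of_pos hr])
  rw [h, integral_abs_cos_circle]
  norm_num

theorem average_face {ε δ : ℝ} (hε : ε ^ 2 = 1) (hδ : δ ^ 2 = 1) :
    ∫ u : sphere (0 : E3) 1, |(u : E3) 0 + ε * (u : E3) 1 + δ * (u : E3) 2| ∂sphereUniform =
      √3 / 2 := by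
  have h3 : √3 * √3 = 3 := mul_self_sqrt (by norm_num)
  let v : E3 := !₂[1 / √3, ε / √3, δ / √3]
  have hin (u : E3) : inner ℝ v u = (u 0 + ε * u 1 + δ * u 2) / √3 := by
    simp [v, PiLp.inner_apply, Fin.sum_univ_three]
    ring
  have hv : ‖v‖ = 1 := by
    have h : inner ℝ v v = (1 : ℝ) := by
      rw [hin]
      simp [v]
      field_simp
      rw [hε, hδ, sq √3, h3]
      norm_num
    rw [real_inner_self_eq_norm_sq] at h
    exact (pow_eq_one_iff_of_nonneg (norm_nonneg _) two_ne_zero).1 h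
  -- A companion orthogonal to the face normal, since `1 - ε² = 0`; the integrand depends on the
  -- normal coordinate alone.
  have hvw : inner ℝ v (diagonalVector 0 1 (-ε)) = (0 : ℝ) := by
    rw [real_inner_comm, inner_diagonalVector]
    simp [v]
    field_simp
    rw [hε]
    simp
  have h := average_abs_inner hv (norm_diagonalVector (i := 0) (j := 1) (by decide)
    (by rw [neg_sq, hε])) hvw
  simp only [hin, abs_div, abs_of_pos (sqrt_pos.2 (by norm_num : (0 : ℝ) < 3)),
    integral_div] at h
  field_simp at h ⊢
  linarith

/-- Surface measure is a multiple of the volume of the cone over a set, and the cone over a great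
circle lies in a plane. -/
theorem ae_inner_ne_zero {v : E3} (hv : v ≠ 0) :
    ∀ᵐ u : sphere (0 : E3) 1 ∂sphereUniform, inner ℝ v (u : E3) ≠ 0 := by
  have h0 : (volume : Measure E3).toSphere {u | ¬ inner ℝ v (u : E3) ≠ 0} = 0 := by
    have hm : MeasurableSet {u : sphere (0 : E3) 1 | ¬ inner ℝ v (u : E3) ≠ 0} := by
      simp only [not_not]
      exact (isClosed_eq (by fun_prop) continuous_const).measurableSet
    rw [Measure.toSphere_apply' _ hm]
    have hk := volume_ker_eq_zero (innerSL ℝ v) (x := v) (by simpa using hv)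
    rw [measure_mono_null _ hk, mul_zero]
    rintro _ ⟨r, hr, _, ⟨u, hu, rfl⟩, rfl⟩
    simp only [not_not, mem_ofPred_eq] at hu
    simp [real_inner_smul_right, hu]
  rw [ae_iff, sphereUniform, Measure.smul_apply, h0, smul_zero]

theorem ae_face_ne_zero {ε δ : ℝ} :
    ∀ᵐ u : sphere (0 : E3) 1 ∂sphereUniform,
      (u : E3) 0 + ε * (u : E3) 1 + δ * (u : E3) 2 ≠ 0 := by
  have hv : (!₂[1, ε, δ] : E3) ≠ 0 := by
    intro h
    have := congrArg (fun x : E3 => x 0) h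
    simp at this
  filter_upwards [ae_inner_ne_zero hv] with u hu
  convert hu using 1
  simp [PiLp.inner_apply, Fin.sum_univ_three]
  ring

/-- For any choice of signs, an equality of this kind makes one of the four forms `x ± y ± z`
vanish. -/
theorem ae_abs_ne :
    ∀ᵐ u : sphere (0 : E3) 1 ∂sphereUniform,
      |(u : E3) 0| ≠ |(u : E3) 1| + |(u : E3) 2| ∧ |(u : E3) 1| ≠ |(u : E3) 0| + |(u : E3) 2| ∧
        |(u : E3) 2| ≠ |(u : E3) 0| + |(u : E3) 1| := by
  filter_upwards [ae_face_ne_zero (ε := 1) (δ := 1), ae_face_ne_zero (ε := 1) (δ := -1),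
    ae_face_ne_zero (ε := -1) (δ := 1), ae_face_ne_zero (ε := -1) (δ := -1)] with u h1 h2 h3 h4
  refine ⟨fun h => ?_, fun h => ?_, fun h => ?_⟩ <;>
    rcases abs_choice ((u : E3) 0) with a | a <;> rcases abs_choice ((u : E3) 1) with b | b <;>
    rcases abs_choice ((u : E3) 2) with c | c <;> rw [a, b, c] at h <;>
    first
      | exact h1 (by linarith)
      | exact h2 (by linarith)
      | exact h3 (by linarith)
      | exact h4 (by linarith)

end EdgeAverages

/-! ### Silhouette and face sums, symmetric under signs and permutations -/

section SilhouetteSums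

open Real Set Metric

/-- The contribution of the four edges parallel to the coordinate plane of `p` and `q`, up to a
factor `2`: such an edge is on the silhouette if the two adjacent faces are on different sides. -/
noncomputable def edgePair (f : ℝ → ℝ) (p q r : ℝ) : ℝ :=
  (if (p + 1 * q) ^ 2 < r ^ 2 then f ((p - 1 * q) ^ 2) else 0) +
    (if (p + -1 * q) ^ 2 < r ^ 2 then f ((p - -1 * q) ^ 2) else 0)

/-- Half the sum of a function of the edges over the silhouette. -/
noncomputable def silhouetteSum (f : ℝ → ℝ) (x y z : ℝ) : ℝ :=
  edgePair f x y z + edgePair f x z y + edgePair f y z x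

/-- Changing the sign of `p` or `q` exchanges the two summands. -/
theorem edgePair_abs (f : ℝ → ℝ) (p q r : ℝ) : edgePair f |p| |q| |r| = edgePair f p q r := by
  unfold edgePair
  rw [sq_abs r]
  have e1 : (-p + 1 * q) ^ 2 = (p + -1 * q) ^ 2 := by ring
  have e2 : (-p + -1 * q) ^ 2 = (p + 1 * q) ^ 2 := by ring
  have e3 : (-p - 1 * q) ^ 2 = (p - -1 * q) ^ 2 := by ring
  have e4 : (-p - -1 * q) ^ 2 = (p - 1 * q) ^ 2 := by ring
  have e5 : (-p + 1 * -q) ^ 2 = (p + 1 * q) ^ 2 := by ring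
  have e6 : (-p + -1 * -q) ^ 2 = (p + -1 * q) ^ 2 := by ring
  have e7 : (-p - 1 * -q) ^ 2 = (p - 1 * q) ^ 2 := by ring
  have e8 : (-p - -1 * -q) ^ 2 = (p - -1 * q) ^ 2 := by ring
  have e9 : (p + 1 * -q) ^ 2 = (p + -1 * q) ^ 2 := by ring
  have e10 : (p + -1 * -q) ^ 2 = (p + 1 * q) ^ 2 := by ring
  have e11 : (p - 1 * -q) ^ 2 = (p - -1 * q) ^ 2 := by ring
  have e12 : (p - -1 * -q) ^ 2 = (p - 1 * q) ^ 2 := by ring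
  rcases abs_choice p with a | a <;> rcases abs_choice q with b | b <;> rw [a, b]
  · rw [e9, e10, e11, e12, add_comm]
  · rw [e1, e2, e3, e4, add_comm]
  · rw [e5, e6, e7, e8]

theorem edgePair_comm (f : ℝ → ℝ) (p q r : ℝ) : edgePair f p q r = edgePair f q p r := by
  unfold edgePair
  rw [show (p + 1 * q) ^ 2 = (q + 1 * p) ^ 2 by ring,
    show (p + -1 * q) ^ 2 = (q + -1 * p) ^ 2 by ring,
    show (p - 1 * q) ^ 2 = (q - 1 * p) ^ 2 by ring,
    show (p - -1 * q) ^ 2 = (q - -1 * p) ^ 2 by ring]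

theorem silhouetteSum_abs (f : ℝ → ℝ) (x y z : ℝ) :
    silhouetteSum f |x| |y| |z| = silhouetteSum f x y z := by
  simp only [silhouetteSum, edgePair_abs]

theorem silhouetteSum_swap (f : ℝ → ℝ) (x y z : ℝ) :
    silhouetteSum f x y z = silhouetteSum f x z y := by
  rw [silhouetteSum, silhouetteSum, edgePair_comm f z y]
  ring

theorem silhouetteSum_rotate (f : ℝ → ℝ) (x y z : ℝ) :
    silhouetteSum f x y z = silhouetteSum f y z x := by
  rw [silhouetteSum, silhouetteSum, edgePair_comm f y x, edgePair_comm f z x]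
  ring

/-- When one coordinate dominates, only the edges in the plane of the other two are on the
silhouette. In `silhouetteSum_of_triangle` each coordinate plane contributes one opposite pair. -/
theorem silhouetteSum_of_add_lt (f : ℝ → ℝ) {x y z : ℝ} (hx : 0 ≤ x) (hy : 0 ≤ y)
    (h : x + y < z) : silhouetteSum f x y z = f ((x - y) ^ 2) + f ((x + y) ^ 2) := by
  unfold silhouetteSum edgePair
  rw [if_pos (by nlinarith), if_pos (by nlinarith), if_neg (by nlinarith), if_neg (by nlinarith),
    if_neg (by nlinarith), if_neg (by nlinarith)]
  simp

theorem silhouetteSum_of_triangle (f : ℝ → ℝ) {x y z : ℝ} (hx : 0 ≤ x) (hy : 0 ≤ y) (hz : 0 ≤ z)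
    (h0 : x < y + z) (h1 : y < x + z) (h2 : z < x + y) :
    silhouetteSum f x y z = f ((x + y) ^ 2) + f ((x + z) ^ 2) + f ((y + z) ^ 2) := by
  unfold silhouetteSum edgePair
  rw [if_neg (by nlinarith), if_pos (by nlinarith), if_neg (by nlinarith), if_pos (by nlinarith),
    if_neg (by nlinarith), if_pos (by nlinarith)]
  simp

/-- The sum of the distances to the four planes through the origin parallel to faces, scaled. -/
noncomputable def faceSum (x y z : ℝ) : ℝ :=
  |x + 1 * y + 1 * z| + |x + 1 * y + -1 * z| + |x + -1 * y + 1 * z| + |x + -1 * y + -1 * z|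

theorem faceSum_neg_left (x y z : ℝ) : faceSum (-x) y z = faceSum x y z := by
  unfold faceSum
  rw [show -x + 1 * y + 1 * z = -(x + -1 * y + -1 * z) by ring,
    show -x + 1 * y + -1 * z = -(x + -1 * y + 1 * z) by ring,
    show -x + -1 * y + 1 * z = -(x + 1 * y + -1 * z) by ring,
    show -x + -1 * y + -1 * z = -(x + 1 * y + 1 * z) by ring]
  simp only [abs_neg]
  ring

theorem faceSum_rotate (x y z : ℝ) : faceSum x y z = faceSum y z x := by
  unfold faceSum
  rw [← abs_neg (x + -1 * y + 1 * z), ← abs_neg (x + -1 * y + -1 * z)]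
  ring_nf

theorem faceSum_abs (x y z : ℝ) : faceSum |x| |y| |z| = faceSum x y z := by
  have key (x y z : ℝ) : faceSum |x| y z = faceSum x y z := by
    rcases abs_choice x with a | a <;> rw [a]
    exact faceSum_neg_left x y z
  rw [key, faceSum_rotate, key, faceSum_rotate, key, faceSum_rotate]

theorem faceSum_of_add_le {x y z : ℝ} (hx : 0 ≤ x) (hy : 0 ≤ y) (h : x + y ≤ z) :
    faceSum x y z = 4 * z := by
  unfold faceSum
  rw [abs_of_nonneg (by linarith), abs_of_nonpos (by linarith), abs_of_nonneg (by linarith),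
    abs_of_nonpos (by linarith)]
  ring

theorem faceSum_of_triangle {x y z : ℝ} (h0 : x < y + z) (h1 : y < x + z) (h2 : z < x + y) :
    faceSum x y z = 2 * (x + y + z) := by
  unfold faceSum
  rw [abs_of_nonneg (by linarith), abs_of_nonneg (by linarith), abs_of_nonneg (by linarith),
    abs_of_nonpos (by linarith)]
  ring

/-- Four forms have six cross products, and each product of two forms is, up to sign, a difference
of two squares. This lets every cross term depend on one diagonal and one axis only. -/
theorem faceSum_sq (x y z : ℝ) :
    faceSum x y z ^ 2 = 4 * (x ^ 2 + y ^ 2 + z ^ 2) +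
      2 * (|(x + 1 * y) ^ 2 - z ^ 2| + |(x + -1 * y) ^ 2 - z ^ 2| + |(x + 1 * z) ^ 2 - y ^ 2| +
        |(x + -1 * z) ^ 2 - y ^ 2| + |(y + 1 * z) ^ 2 - x ^ 2| + |(y + -1 * z) ^ 2 - x ^ 2|) := by
  unfold faceSum
  have e1 : (x + 1 * y) ^ 2 - z ^ 2 = (x + 1 * y + 1 * z) * (x + 1 * y + -1 * z) := by ring
  have e2 : (x + -1 * y) ^ 2 - z ^ 2 = (x + -1 * y + 1 * z) * (x + -1 * y + -1 * z) := by ring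
  have e3 : (x + 1 * z) ^ 2 - y ^ 2 = (x + 1 * y + 1 * z) * (x + -1 * y + 1 * z) := by ring
  have e4 : (x + -1 * z) ^ 2 - y ^ 2 = (x + 1 * y + -1 * z) * (x + -1 * y + -1 * z) := by ring
  have e5 : (y + 1 * z) ^ 2 - x ^ 2 = -((x + 1 * y + 1 * z) * (x + -1 * y + -1 * z)) := by ring
  have e6 : (y + -1 * z) ^ 2 - x ^ 2 = -((x + 1 * y + -1 * z) * (x + -1 * y + 1 * z)) := by ring
  rw [e1, e2, e3, e4, e5, e6]
  simp only [abs_neg, abs_mul]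
  have s1 := sq_abs (x + 1 * y + 1 * z)
  have s2 := sq_abs (x + 1 * y + -1 * z)
  have s3 := sq_abs (x + -1 * y + 1 * z)
  have s4 := sq_abs (x + -1 * y + -1 * z)
  linear_combination s1 + s2 + s3 + s4

end SilhouetteSums

/-! ### Means and distribution for a random direction -/

section RandomShadow

open Real Set Metric

variable {u : E3}

/-- The area formula is Cauchy's: half the sum of the projected face areas. It holds for every
direction, since the two area formulas agree when a face is seen edge-on. -/
theorem shadow_trichotomy (hu : ‖u‖ = 1) :
    chorowidth u = faceSum (u 0) (u 1) (u 2) / 4 ∧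
    (shadowVertexCount u = 4 ∨ shadowVertexCount u = 6) ∧
    (shadowVertexCount u = 6 ↔
      |u 0| < |u 1| + |u 2| ∧ |u 1| < |u 0| + |u 2| ∧ |u 2| < |u 0| + |u 1|) := by
  have a0 := abs_nonneg (u 0)
  have a1 := abs_nonneg (u 1)
  have a2 := abs_nonneg (u 2)
  rw [← faceSum_abs]
  by_cases h0 : |u 1| + |u 2| ≤ |u 0|
  · obtain ⟨e1, -, e3⟩ := shadow_of_abs_add_abs_le hu (i := 1) (j := 2) (k := 0) (by decide)
      (by decide) (by decide) h0
    rw [e1, e3, faceSum_rotate, faceSum_of_add_le a1 a2 h0]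
    exact ⟨by ring, Or.inl rfl, iff_of_false (by norm_num) fun h => absurd h.1 (not_lt.2 h0)⟩
  by_cases h1 : |u 2| + |u 0| ≤ |u 1|
  · obtain ⟨e1, -, e3⟩ := shadow_of_abs_add_abs_le hu (i := 2) (j := 0) (k := 1) (by decide)
      (by decide) (by decide) h1
    rw [e1, e3, faceSum_rotate, faceSum_rotate, faceSum_of_add_le a2 a0 h1]
    exact ⟨by ring, Or.inl rfl, iff_of_false (by norm_num) fun h => by linarith [h.2.1]⟩
  by_cases h2 : |u 0| + |u 1| ≤ |u 2|
  · obtain ⟨e1, -, e3⟩ := shadow_of_abs_add_abs_le hu (i := 0) (j := 1) (k := 2) (by decide)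
      (by decide) (by decide) h2
    rw [e1, e3, faceSum_of_add_le a0 a1 h2]
    exact ⟨by ring, Or.inl rfl, iff_of_false (by norm_num) fun h => absurd h.2.2 (not_lt.2 h2)⟩
  push Not at h0 h1 h2
  rw [add_comm] at h1
  obtain ⟨e1, -, e3⟩ := shadow_of_abs_lt_abs_add_abs hu h0 h1 h2
  rw [e1, e3, faceSum_of_triangle h0 h1 h2]
  exact ⟨by ring, Or.inr rfl, iff_of_true rfl ⟨h0, h1, h2⟩⟩

/-- Ties are excluded because the strict silhouette condition loses edges of a face seen edge-on.
Edges and vertices of a polygon are equal in number, which gives the count. -/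
theorem shadow_silhouette (hu : ‖u‖ = 1) (h0 : |u 0| ≠ |u 1| + |u 2|)
    (h1 : |u 1| ≠ |u 0| + |u 2|) (h2 : |u 2| ≠ |u 0| + |u 1|) :
    periwidth u = √2 * silhouetteSum (fun t => √(2 - t)) (u 0) (u 1) (u 2) ∧
      (shadowVertexCount u : ℝ) = 2 * silhouetteSum (fun _ => 1) (u 0) (u 1) (u 2) := by
  have a0 := abs_nonneg (u 0)
  have a1 := abs_nonneg (u 1)
  have a2 := abs_nonneg (u 2)
  rw [← silhouetteSum_abs, ← silhouetteSum_abs (fun _ => 1)]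
  rcases h0.lt_or_gt with h0 | h0
  swap
  · obtain ⟨-, e2, e3⟩ := shadow_of_abs_add_abs_le hu (i := 1) (j := 2) (k := 0) (by decide)
      (by decide) (by decide) h0.le
    rw [e2, e3, silhouetteSum_rotate, silhouetteSum_of_add_lt _ a1 a2 h0, silhouetteSum_rotate,
      silhouetteSum_of_add_lt _ a1 a2 h0]
    norm_num
  rcases h1.lt_or_gt with h1 | h1
  swap
  · obtain ⟨-, e2, e3⟩ := shadow_of_abs_add_abs_le hu (i := 0) (j := 2) (k := 1) (by decide)
      (by decide) (by decide) h1.le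
    rw [e2, e3, silhouetteSum_swap, silhouetteSum_of_add_lt _ a0 a2 h1, silhouetteSum_swap,
      silhouetteSum_of_add_lt _ a0 a2 h1]
    norm_num
  rcases h2.lt_or_gt with h2 | h2
  swap
  · obtain ⟨-, e2, e3⟩ := shadow_of_abs_add_abs_le hu (i := 0) (j := 1) (k := 2) (by decide)
      (by decide) (by decide) h2.le
    rw [e2, e3, silhouetteSum_of_add_lt _ a0 a1 h2, silhouetteSum_of_add_lt _ a0 a1 h2]
    norm_num
  obtain ⟨-, e2, e3⟩ := shadow_of_abs_lt_abs_add_abs hu h0 h1 h2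
  rw [e2, e3, silhouetteSum_of_triangle _ a0 a1 a2 h0 h1 h2,
    silhouetteSum_of_triangle _ a0 a1 a2 h0 h1 h2]
  norm_num

/-- `f` is integrable on the sphere with mean value `c`. -/
def HasAverage (f : sphere (0 : E3) 1 → ℝ) (c : ℝ) : Prop :=
  Integrable f sphereUniform ∧ ∫ u, f u ∂sphereUniform = c

theorem HasAverage.add {f g : sphere (0 : E3) 1 → ℝ} {a b : ℝ} (hf : HasAverage f a)
    (hg : HasAverage g b) : HasAverage (fun u => f u + g u) (a + b) :=
  ⟨hf.1.add hg.1, by rw [integral_add hf.1 hg.1, hf.2, hg.2]⟩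

theorem HasAverage.const_mul {f : sphere (0 : E3) 1 → ℝ} {a : ℝ} (c : ℝ) (hf : HasAverage f a) :
    HasAverage (fun u => c * f u) (c * a) :=
  ⟨hf.1.const_mul c, by rw [integral_const_mul, hf.2]⟩

theorem hasAverage_const (c : ℝ) : HasAverage (fun _ => c) c :=
  ⟨integrable_const c, by simp⟩

theorem integrable_of_continuous_sphere {f : sphere (0 : E3) 1 → ℝ} (hf : Continuous f) :
    Integrable f sphereUniform :=
  hf.integrable_of_hasCompactSupport (HasCompactSupport.of_compactSpace f)

theorem integrable_edge {f : ℝ → ℝ} (hf : Continuous f) (i j k : Fin 3) (ε : ℝ) :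
    Integrable (fun u : sphere (0 : E3) 1 =>
      if ((u : E3) i + ε * (u : E3) j) ^ 2 < (u : E3) k ^ 2
        then f (((u : E3) i - ε * (u : E3) j) ^ 2) else 0) sphereUniform := by
  have h1 : Integrable (fun u : sphere (0 : E3) 1 => f (((u : E3) i - ε * (u : E3) j) ^ 2))
      sphereUniform := integrable_of_continuous_sphere (by fun_prop)
  have hm : MeasurableSet {u : sphere (0 : E3) 1 |
      ((u : E3) i + ε * (u : E3) j) ^ 2 < (u : E3) k ^ 2} :=
    (isOpen_lt (by fun_prop) (by fun_prop)).measurableSet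
  refine (h1.indicator hm).congr (Filter.Eventually.of_forall fun u => ?_)
  simp [indicator]

theorem hasAverage_silhouetteSum {f : ℝ → ℝ} (hf : Continuous f) {c : ℝ}
    (hc : ∀ (i j k : Fin 3) (ε : ℝ), i ≠ j → i ≠ k → j ≠ k → ε ^ 2 = 1 →
      ∫ u : sphere (0 : E3) 1, (if ((u : E3) i + ε * (u : E3) j) ^ 2 < (u : E3) k ^ 2
        then f (((u : E3) i - ε * (u : E3) j) ^ 2) else 0) ∂sphereUniform = c) :
    HasAverage (fun u => silhouetteSum f ((u : E3) 0) ((u : E3) 1) ((u : E3) 2)) (6 * c) := by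
  have hp (i j k : Fin 3) (hij : i ≠ j) (hik : i ≠ k) (hjk : j ≠ k) :
      HasAverage (fun u => edgePair f ((u : E3) i) ((u : E3) j) ((u : E3) k)) (c + c) :=
    HasAverage.add ⟨integrable_edge hf i j k 1, hc i j k 1 hij hik hjk (by norm_num)⟩
      ⟨integrable_edge hf i j k (-1), hc i j k (-1) hij hik hjk (by norm_num)⟩
  have h := ((hp 0 1 2 (by decide) (by decide) (by decide)).add
    (hp 0 2 1 (by decide) (by decide) (by decide))).add
      (hp 1 2 0 (by decide) (by decide) (by decide))
  rw [show 6 * c = c + c + (c + c) + (c + c) by ring]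
  exact h

theorem chorowidth_eq_faceSum :
    (fun u : sphere (0 : E3) 1 => chorowidth u) =
      fun u : sphere (0 : E3) 1 => faceSum ((u : E3) 0) ((u : E3) 1) ((u : E3) 2) / 4 := by
  ext u
  exact (shadow_trichotomy (norm_eq_of_mem_sphere u)).1

theorem continuous_chorowidth_sphere : Continuous fun u : sphere (0 : E3) 1 => chorowidth u := by
  rw [chorowidth_eq_faceSum]
  unfold faceSum
  fun_prop

theorem integral_chorowidth :
    ∫ u : sphere (0 : E3) 1, chorowidth u ∂sphereUniform = √3 / 2 := by
  have hi (ε δ : ℝ) (hε : ε ^ 2 = 1) (hδ : δ ^ 2 = 1) :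
      HasAverage (fun u => |(u : E3) 0 + ε * (u : E3) 1 + δ * (u : E3) 2|) (√3 / 2) :=
    ⟨integrable_of_continuous_sphere (by fun_prop), average_face hε hδ⟩
  have h := (((hi 1 1 (by norm_num) (by norm_num)).add (hi 1 (-1) (by norm_num) (by norm_num))).add
    (hi (-1) 1 (by norm_num) (by norm_num))).add (hi (-1) (-1) (by norm_num) (by norm_num))
  rw [chorowidth_eq_faceSum, integral_div]
  unfold faceSum
  rw [h.2]
  ring

theorem integral_chorowidth_sq :
    ∫ u : sphere (0 : E3) 1, chorowidth u ^ 2 ∂sphereUniform =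
      1 / 2 + √2 / π - 1 / (2 * π) * arcsec 3 := by
  let P (i j k : Fin 3) (ε : ℝ) (u : sphere (0 : E3) 1) : ℝ :=
    |((u : E3) i + ε * (u : E3) j) ^ 2 - (u : E3) k ^ 2|
  have hP (i j k : Fin 3) (hij : i ≠ j) (hik : i ≠ k) (hjk : j ≠ k) (ε : ℝ) (hε : ε ^ 2 = 1) :
      HasAverage (P i j k ε) (1 / (3 * π) * (π - 2 * arcsec 3 + 4 * √2)) :=
    ⟨integrable_of_continuous_sphere (by fun_prop), average_edge_product hij hik hjk hε⟩
  have e : (fun u : sphere (0 : E3) 1 => chorowidth u ^ 2) = fun u => 1 / 4 + 1 / 8 *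
      (P 0 1 2 1 u + P 0 1 2 (-1) u + P 0 2 1 1 u + P 0 2 1 (-1) u + P 1 2 0 1 u +
        P 1 2 0 (-1) u) := by
    ext u
    rw [congrFun chorowidth_eq_faceSum u, div_pow, faceSum_sq,
      sum_sq_sphere (by decide) (by decide) (by decide)]
    ring
  have h := (hasAverage_const (1 / 4)).add
    (((((((hP 0 1 2 (by decide) (by decide) (by decide) 1 (by norm_num)).add
      (hP 0 1 2 (by decide) (by decide) (by decide) (-1) (by norm_num))).add
      (hP 0 2 1 (by decide) (by decide) (by decide) 1 (by norm_num))).add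
      (hP 0 2 1 (by decide) (by decide) (by decide) (-1) (by norm_num))).add
      (hP 1 2 0 (by decide) (by decide) (by decide) 1 (by norm_num))).add
      (hP 1 2 0 (by decide) (by decide) (by decide) (-1) (by norm_num))).const_mul (1 / 8))
  rw [e, h.2]
  field_simp
  ring

/-- Integrability is inherited from the silhouette sum, which agrees with the circumference almost
everywhere. -/
theorem integrable_integral_periwidth :
    Integrable (fun u : sphere (0 : E3) 1 => periwidth u) sphereUniform ∧
      ∫ u : sphere (0 : E3) 1, periwidth u ∂sphereUniform = 3 * arcsec 3 := by
  have hs := hasAverage_silhouetteSum (f := fun t => √(2 - t)) (by fun_prop)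
    fun i j k ε hij hik hjk hε => average_edge_length hij hik hjk hε
  have hae : (fun u : sphere (0 : E3) 1 => periwidth u) =ᵐ[sphereUniform] fun u =>
      √2 * silhouetteSum (fun t => √(2 - t)) ((u : E3) 0) ((u : E3) 1) ((u : E3) 2) := by
    filter_upwards [ae_abs_ne] with u hu
    exact (shadow_silhouette (norm_eq_of_mem_sphere u) hu.1 hu.2.1 hu.2.2).1
  refine ⟨(hs.1.const_mul _).congr hae.symm, ?_⟩
  rw [integral_congr_ae hae, integral_const_mul, hs.2]
  have h2 : √2 * √2 = 2 := mul_self_sqrt (by norm_num)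
  linear_combination (3 / 2) * arcsec 3 * h2

/-- The number of vertices is 4 plus twice the indicator of a hexagonal shadow, so its mean `12
arcsec 3 / π` determines both probabilities. -/
theorem measureReal_shadowVertexCount :
    sphereUniform.real {u | shadowVertexCount u = 4} = 3 / π * (π - 2 * arcsec 3) ∧
      sphereUniform.real {u | shadowVertexCount u = 6} = 2 / π * (3 * arcsec 3 - π) := by
  have hs := hasAverage_silhouetteSum (f := fun _ => 1) continuous_const
    fun i j k ε hij hik hjk hε => average_edge_indicator hij hik hjk hε
  have tri (u : sphere (0 : E3) 1) := shadow_trichotomy (norm_eq_of_mem_sphere u)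
  have hm : MeasurableSet {u : sphere (0 : E3) 1 | shadowVertexCount u = 6} := by
    simp only [fun u => (tri u).2.2]
    have o (i j k : Fin 3) :
        IsOpen {u : sphere (0 : E3) 1 | |(u : E3) i| < |(u : E3) j| + |(u : E3) k|} :=
      isOpen_lt (by fun_prop) (by fun_prop)
    exact ((o 0 1 2).inter ((o 1 0 2).inter (o 2 0 1))).measurableSet
  have hcompl : {u : sphere (0 : E3) 1 | shadowVertexCount u = 4} =
      {u : sphere (0 : E3) 1 | shadowVertexCount u = 6}ᶜ := by
    ext u
    simp only [mem_ofPred_eq, mem_compl_iff]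
    rcases (tri u).2.1 with h | h <;> simp [h]
  have hae : (fun u : sphere (0 : E3) 1 =>
      4 + 2 * {u : sphere (0 : E3) 1 | shadowVertexCount u = 6}.indicator 1 u)
        =ᵐ[sphereUniform] fun u =>
      2 * silhouetteSum (fun _ => 1) ((u : E3) 0) ((u : E3) 1) ((u : E3) 2) := by
    filter_upwards [ae_abs_ne] with u hu
    rw [← (shadow_silhouette (norm_eq_of_mem_sphere u) hu.1 hu.2.1 hu.2.2).2]
    rcases (tri u).2.1 with h | h <;> simp [h, indicator]
    norm_num
  have h6 : sphereUniform.real {u | shadowVertexCount u = 6} = 2 / π * (3 * arcsec 3 - π) := by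
    have h := integral_congr_ae hae
    have hint : Integrable ({u : sphere (0 : E3) 1 | shadowVertexCount u = 6}.indicator
        (1 : sphere (0 : E3) 1 → ℝ)) sphereUniform := (integrable_const (1 : ℝ)).indicator hm
    rw [integral_add (integrable_const _) (hint.const_mul _), integral_const_mul,
      integral_indicator_one hm, integral_const_mul, hs.2] at h
    simp at h
    field_simp at h ⊢
    linarith
  refine ⟨?_, h6⟩
  rw [hcompl, probReal_compl_eq_one_sub hm, h6]
  field_simp
  ring

end RandomShadow

/-! ### The octahedron as a ball of the sum norm, and its surface area -/

section SurfaceArea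

open Real Set

/-- The sign `±1` that encodes a boolean. -/
noncomputable def boolSign (e : Bool) : ℝ := if e then 1 else -1

theorem boolSign_sq (e : Bool) : boolSign e ^ 2 = 1 := by
  cases e <;> simp [boolSign]

theorem boolSign_mul_le_abs (e : Bool) (t : ℝ) : boolSign e * t ≤ |t| := by
  cases e
  · simpa [boolSign] using neg_le_abs t
  · simpa [boolSign] using le_abs_self t

theorem exists_boolSign_mul_eq_abs (t : ℝ) : ∃ e, boolSign e * t = |t| := by
  rcases abs_choice t with h | h
  · exact ⟨true, by simp [boolSign, h]⟩
  · exact ⟨false, by simp [boolSign, h]⟩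

theorem octahedron_eq :
    octahedron = {x : E3 | |x 0| + |x 1| + |x 2| ≤ 1 / √2} := by
  have hs : 0 < 1 / √2 := by positivity
  apply Set.Subset.antisymm
  · refine convexHull_min ?_ ?_
    · rintro x ⟨i, rfl | rfl⟩ <;> fin_cases i <;> simp [abs_of_nonneg (sqrt_nonneg (2 : ℝ))]
    · intro x hx y hy a b ha hb hab
      simp only [mem_ofPred_eq] at hx hy
      simp only [mem_ofPred_eq, PiLp.add_apply, PiLp.smul_apply, smul_eq_mul]
      have h (i : Fin 3) : |a * x i + b * y i| ≤ a * |x i| + b * |y i| := by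
        refine (abs_add_le _ _).trans ?_
        rw [abs_mul, abs_mul, abs_of_nonneg ha, abs_of_nonneg hb]
      have h1 := mul_le_mul_of_nonneg_left hx ha
      have h2 := mul_le_mul_of_nonneg_left hy hb
      have h3 : a * (1 / √2) + b * (1 / √2) = 1 / √2 := by rw [← add_mul, hab, one_mul]
      linarith [h 0, h 1, h 2]
  · intro x hx
    rw [mem_ofPred_eq] at hx
    have hC : Convex ℝ octahedron := convex_convexHull ℝ _
    have hmem (i : Fin 3) (e : Bool) :
        EuclideanSpace.single i (boolSign e * (1 / √2)) ∈ octahedron := by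
      apply subset_convexHull
      refine ⟨i, ?_⟩
      cases e <;> simp [boolSign]
    have h0 : (0 : E3) ∈ octahedron := by
      have := hC (hmem 0 true) (hmem 0 false) (show (0 : ℝ) ≤ 1 / 2 by norm_num)
        (show (0 : ℝ) ≤ 1 / 2 by norm_num) (by norm_num)
      convert this using 1
      ext i
      fin_cases i <;> simp [boolSign]
    obtain ⟨e0, h0'⟩ := exists_boolSign_mul_eq_abs (x 0)
    obtain ⟨e1, h1'⟩ := exists_boolSign_mul_eq_abs (x 1)
    obtain ⟨e2, h2'⟩ := exists_boolSign_mul_eq_abs (x 2)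
    -- Each coordinate puts weight `√2 |x i|` on the vertex of its own sign, and the remaining mass
    -- goes to the centre.
    have h := hC.sum_mem (t := Finset.univ)
      (w := ![|x 0| * √2, |x 1| * √2, |x 2| * √2, 1 - (|x 0| + |x 1| + |x 2|) * √2])
      (z := ![EuclideanSpace.single 0 (boolSign e0 * (1 / √2)),
        EuclideanSpace.single 1 (boolSign e1 * (1 / √2)),
        EuclideanSpace.single 2 (boolSign e2 * (1 / √2)), 0])
      (by
        intro i _
        rw [le_div_iff₀ (by positivity)] at hx
        fin_cases i <;> simp <;> first | positivity | linarith)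
      (by simp [Fin.sum_univ_four]; ring)
      (by intro i _; fin_cases i <;> simp [-one_div, hmem, h0])
    convert h using 1
    have q : √2 * (√2)⁻¹ = 1 := mul_inv_cancel₀ (by positivity)
    ext i
    fin_cases i
    · simp [Fin.sum_univ_four, ← h0']
      linear_combination (-x 0) * boolSign_sq e0 - x 0 * boolSign e0 ^ 2 * q
    · simp [Fin.sum_univ_four, ← h1']
      linear_combination (-x 1) * boolSign_sq e1 - x 1 * boolSign e1 ^ 2 * q
    · simp [Fin.sum_univ_four, ← h2']
      linear_combination (-x 2) * boolSign_sq e2 - x 2 * boolSign e2 ^ 2 * q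

/-- The face of the octahedron in the octant given by three signs. -/
def octahedronFace (e : Bool × Bool × Bool) : Set E3 :=
  {x | 0 ≤ boolSign e.1 * x 0 ∧ 0 ≤ boolSign e.2.1 * x 1 ∧ 0 ≤ boolSign e.2.2 * x 2 ∧
    boolSign e.1 * x 0 + boolSign e.2.1 * x 1 + boolSign e.2.2 * x 2 = 1 / √2}

/-- The octahedron is an intersection of strips indexed by sign triples, opposite triples giving the
same strip. Thus a value `-1` at `e` is a value 1 at the opposite triple. -/
theorem frontier_octahedron : frontier octahedron = ⋃ e, octahedronFace e := by
  let c (e : Bool × Bool × Bool) : E3 :=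
    !₂[√2 * boolSign e.1, √2 * boolSign e.2.1, √2 * boolSign e.2.2]
  let ℓ (e : Bool × Bool × Bool) : E3 →L[ℝ] ℝ := innerSL ℝ (c e)
  have hℓ (e : Bool × Bool × Bool) (x : E3) : ℓ e x =
      √2 * (boolSign e.1 * x 0 + boolSign e.2.1 * x 1 + boolSign e.2.2 * x 2) := by
    simp [ℓ, c, PiLp.inner_apply, Fin.sum_univ_three]
    ring
  have hs : 0 < √2 := by positivity
  have hneg (e : Bool) : boolSign (!e) = -boolSign e := by cases e <;> simp [boolSign]
  have hP : octahedron = bandPolytope ℓ := by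
    rw [octahedron_eq]
    ext x
    simp only [mem_ofPred_eq, bandPolytope, hℓ]
    rw [le_div_iff₀ hs]
    constructor
    · intro h e
      rw [abs_mul, abs_of_pos hs]
      have h1 := boolSign_mul_le_abs e.1 (x 0)
      have h2 := boolSign_mul_le_abs e.2.1 (x 1)
      have h3 := boolSign_mul_le_abs e.2.2 (x 2)
      have h4 := boolSign_mul_le_abs (!e.1) (x 0)
      have h5 := boolSign_mul_le_abs (!e.2.1) (x 1)
      have h6 := boolSign_mul_le_abs (!e.2.2) (x 2)
      rw [hneg] at h4 h5 h6
      refine le_trans ?_ h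
      rw [mul_comm]
      refine mul_le_mul_of_nonneg_right (abs_le.2 ⟨?_, ?_⟩) hs.le <;> linarith
    · intro h
      obtain ⟨e0, h0⟩ := exists_boolSign_mul_eq_abs (x 0)
      obtain ⟨e1, h1⟩ := exists_boolSign_mul_eq_abs (x 1)
      obtain ⟨e2, h2⟩ := exists_boolSign_mul_eq_abs (x 2)
      have := (abs_le.1 (h (e0, e1, e2))).2
      simp only [h0, h1, h2] at this
      linarith
  have hmem (x : E3) (hx : |x 0| + |x 1| + |x 2| ≤ 1 / √2) (e : Bool × Bool × Bool)
      (he : boolSign e.1 * x 0 + boolSign e.2.1 * x 1 + boolSign e.2.2 * x 2 = 1 / √2) :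
      x ∈ octahedronFace e := by
    have h1 := boolSign_mul_le_abs e.1 (x 0)
    have h2 := boolSign_mul_le_abs e.2.1 (x 1)
    have h3 := boolSign_mul_le_abs e.2.2 (x 2)
    exact ⟨by linarith [abs_nonneg (x 0)], by linarith [abs_nonneg (x 1)],
      by linarith [abs_nonneg (x 2)], he⟩
  have hP' : ∀ x, x ∈ bandPolytope ℓ ↔ |x 0| + |x 1| + |x 2| ≤ 1 / √2 := by
    intro x
    rw [← hP, octahedron_eq]
    rfl
  rw [hP, frontier_bandPolytope]
  ext x
  simp only [mem_ofPred_eq, mem_iUnion, hP', hℓ]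
  constructor
  · rintro ⟨hx, e, he⟩
    rcases eq_or_eq_neg_of_abs_eq he with h | h
    · exact ⟨e, hmem x hx e (by rw [eq_div_iff hs.ne']; linarith)⟩
    · refine ⟨(!e.1, !e.2.1, !e.2.2), hmem x hx _ ?_⟩
      simp only [hneg]
      rw [eq_div_iff hs.ne']
      linarith
  · rintro ⟨e, h0, h1, h2, h3⟩
    refine ⟨?_, e, ?_⟩
    · rw [← h3]
      have habs (e : Bool) (t : ℝ) (h : 0 ≤ boolSign e * t) : |t| = boolSign e * t := by
        rw [← abs_of_nonneg h, abs_mul]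
        cases e <;> simp [boolSign]
      rw [habs _ _ h0, habs _ _ h1, habs _ _ h2]
    · rw [h3, mul_one_div_cancel hs.ne', abs_one]

/-- Translated by one vertex, the face is a corner triangle whose sides have length 1 and inner
product `1/2`, so its Gram determinant is `3/4`. -/
theorem measure_octahedronFace (e : Bool × Bool × Bool) :
    μHE[2] (octahedronFace e) = ENNReal.ofReal (√3 / 4) := by
  obtain ⟨e0, e1, e2⟩ := e
  let A : E3 := EuclideanSpace.single 0 (boolSign e0 / √2)
  let B : E3 := EuclideanSpace.single 1 (boolSign e1 / √2)
  let C : E3 := EuclideanSpace.single 2 (boolSign e2 / √2)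
  have hs : 0 < √2 := by positivity
  have q : √2 * √2 = 2 := mul_self_sqrt (by norm_num)
  have s0 := boolSign_sq e0
  have s1 := boolSign_sq e1
  have s2 := boolSign_sq e2
  have hface : octahedronFace (e0, e1, e2) =
      (fun x => A + x) '' cornerTriangle (B - A) (C - A) := by
    ext x
    constructor
    · rintro ⟨h0, h1, h2, h3⟩
      simp only at h0 h1 h2 h3
      refine ⟨x - A, ⟨√2 * (boolSign e1 * x 1), √2 * (boolSign e2 * x 2), by positivity,
        by positivity, ?_, ?_⟩, by simp⟩
      · rw [eq_div_iff hs.ne'] at h3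
        nlinarith
      · rw [eq_div_iff hs.ne'] at h3
        ext i
        fin_cases i
        · simp [A, B, C]
          field_simp
          linear_combination (-√2 * x 0) * s0 + boolSign e0 * h3
        · simp [A, B, C]
          field_simp
          linear_combination (-x 1) * s1
        · simp [A, B, C]
          field_simp
          linear_combination (-x 2) * s2
    · rintro ⟨_, ⟨α, β, h0, h1, h2, rfl⟩, rfl⟩
      refine ⟨?_, ?_, ?_, ?_⟩
      · have : boolSign e0 * (A + (α • (B - A) + β • (C - A))) 0 = (1 - α - β) / √2 := by
          simp [A, B, C]
          field_simp
          linear_combination (1 - α - β) * s0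
        rw [this]
        exact div_nonneg (by linarith) hs.le
      · have : boolSign e1 * (A + (α • (B - A) + β • (C - A))) 1 = α / √2 := by
          simp [A, B, C]
          field_simp
          linear_combination α * s1
        rw [this]
        exact div_nonneg h0 hs.le
      · have : boolSign e2 * (A + (α • (B - A) + β • (C - A))) 2 = β / √2 := by
          simp [A, B, C]
          field_simp
          linear_combination β * s2
        rw [this]
        exact div_nonneg h1 hs.le
      · simp [A, B, C]
        field_simp
        linear_combination (1 - α - β) * s0 + α * s1 + β * s2
  have hAA : inner ℝ A A = (1 / 2 : ℝ) := by
    simp [A]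
    field_simp
    rw [sq_abs, sq_abs, s0, sq √2, q, one_mul]
  have hBB : inner ℝ B B = (1 / 2 : ℝ) := by
    simp [B]
    field_simp
    rw [sq_abs, sq_abs, s1, sq √2, q, one_mul]
  have hCC : inner ℝ C C = (1 / 2 : ℝ) := by
    simp [C]
    field_simp
    rw [sq_abs, sq_abs, s2, sq √2, q, one_mul]
  have hAB : inner ℝ A B = (0 : ℝ) := by
    simp [A, B, EuclideanSpace.inner_single_left]
  have hAC : inner ℝ A C = (0 : ℝ) := by
    simp [A, C, EuclideanSpace.inner_single_left]
  have hBC : inner ℝ B C = (0 : ℝ) := by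
    simp [B, C, EuclideanSpace.inner_single_left]
  have hBA : inner ℝ B A = (0 : ℝ) := by
    simp [A, B, EuclideanSpace.inner_single_left]
  have hCA : inner ℝ C A = (0 : ℝ) := by
    simp [A, C, EuclideanSpace.inner_single_left]
  rw [hface, (isometry_add_left A).euclideanHausdorffMeasure_image,
    euclideanHausdorffMeasure_cornerTriangle]
  simp only [← real_inner_self_eq_norm_sq, inner_sub_left, inner_sub_right, hAA, hBB, hCC, hAB,
    hAC, hBC, hBA, hCA]
  rw [show (1 / 2 - 0 - (0 - 1 / 2)) * (1 / 2 - 0 - (0 - 1 / 2)) - (0 - 0 - (0 - 1 / 2)) ^ 2 =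
    (1 / 2) ^ 2 * (3 : ℝ) by norm_num, sqrt_mul (by norm_num), sqrt_sq (by norm_num)]
  congr 1
  ring

theorem euclideanHausdorffMeasure_two_range_eq_zero {g : ℝ → E3} (hg : ContDiff ℝ 1 g) :
    μHE[2] (range g) = 0 := by
  have h1 : dimH (range g) < (2 : NNReal) := by
    refine hg.dimH_range_le.trans_lt ?_
    simp
  have h2 := hausdorffMeasure_of_dimH_lt h1
  rw [Measure.euclideanHausdorffMeasure_def, Measure.smul_apply]
  have h3 : μH[((2 : ℕ) : ℝ)] (range g) = 0 := by
    convert h2 using 2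
    simp
  rw [h3, smul_zero]

/-- Where two sign triples differ, the corresponding coordinate vanishes on both faces. The
intersection then lies on a line parametrized by one of the other coordinates, and a smooth curve
has no area. -/
theorem aedisjoint_octahedronFace :
    Pairwise (Function.onFun (AEDisjoint μHE[2]) octahedronFace) := by
  have key (a b : Bool) (h : a ≠ b) (t : ℝ) (h1 : 0 ≤ boolSign a * t) (h2 : 0 ≤ boolSign b * t) :
      t = 0 := by
    cases a <;> cases b <;> simp [boolSign] at h h1 h2 <;> linarith
  rintro ⟨a0, a1, a2⟩ ⟨b0, b1, b2⟩ hab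
  have sa1 := boolSign_sq a1
  have sa2 := boolSign_sq a2
  by_cases h0 : a0 = b0
  · by_cases h1 : a1 = b1
    · have h2 : a2 ≠ b2 := fun h => hab (by rw [h0, h1, h])
      refine measure_mono_null ?_ (euclideanHausdorffMeasure_two_range_eq_zero
        (g := fun t => !₂[t, boolSign a1 * (1 / √2 - boolSign a0 * t), 0])
        (contDiff_euclidean.2 fun i => by fin_cases i <;> simp <;> fun_prop))
      rintro x ⟨⟨-, -, hx2, hx3⟩, ⟨-, -, hx2', -⟩⟩
      have e := key _ _ h2 _ hx2 hx2'
      simp only at hx3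
      refine ⟨x 0, ?_⟩
      ext i
      fin_cases i
      · simp
      · simp only [← hx3, e]
        simp
        linear_combination x 1 * sa1
      · simp [e]
    · refine measure_mono_null ?_ (euclideanHausdorffMeasure_two_range_eq_zero
        (g := fun t => !₂[t, 0, boolSign a2 * (1 / √2 - boolSign a0 * t)])
        (contDiff_euclidean.2 fun i => by fin_cases i <;> simp <;> fun_prop))
      rintro x ⟨⟨-, hx2, -, hx3⟩, ⟨-, hx2', -, -⟩⟩
      have e := key _ _ h1 _ hx2 hx2'
      simp only at hx3
      refine ⟨x 0, ?_⟩
      ext i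
      fin_cases i
      · simp
      · simp [e]
      · simp only [← hx3, e]
        simp
        linear_combination x 2 * sa2
  · refine measure_mono_null ?_ (euclideanHausdorffMeasure_two_range_eq_zero
      (g := fun t => !₂[0, t, boolSign a2 * (1 / √2 - boolSign a1 * t)])
      (contDiff_euclidean.2 fun i => by fin_cases i <;> simp <;> fun_prop))
    rintro x ⟨⟨hx2, -, -, hx3⟩, ⟨hx2', -, -, -⟩⟩
    have e := key _ _ h0 _ hx2 hx2'
    simp only at hx3
    refine ⟨x 1, ?_⟩
    ext i
    fin_cases i
    · simp [e]
    · simp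
    · simp only [← hx3, e]
      simp
      linear_combination x 2 * sa2

theorem isClosed_octahedronFace (e : Bool × Bool × Bool) : IsClosed (octahedronFace e) := by
  have o (a : Bool) (i : Fin 3) : IsClosed {x : E3 | 0 ≤ boolSign a * x i} :=
    isClosed_le (by fun_prop) (by fun_prop)
  have h : IsClosed {x : E3 |
      boolSign e.1 * x 0 + boolSign e.2.1 * x 1 + boolSign e.2.2 * x 2 = 1 / √2} :=
    isClosed_eq (by fun_prop) (by fun_prop)
  exact (o e.1 0).inter ((o e.2.1 1).inter ((o e.2.2 2).inter h))

theorem octahedronSurfaceArea_eq : octahedronSurfaceArea = 2 * √3 := by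
  rw [octahedronSurfaceArea, frontier_octahedron, measure_iUnion₀ aedisjoint_octahedronFace
    fun e => (isClosed_octahedronFace e).nullMeasurableSet]
  simp only [measure_octahedronFace]
  rw [tsum_fintype, Finset.sum_const, nsmul_eq_mul, ENNReal.toReal_mul,
    ENNReal.toReal_ofReal (by positivity)]
  simp
  ring

end SurfaceArea

/-! ### The complete statement -/

theorem mainTheorem3 :
    -- moments of the area and of the circumference of a random shadow
    Integrable (fun u : Metric.sphere (0 : E3) 1 => chorowidth u) sphereUniform ∧
    Integrable (fun u : Metric.sphere (0 : E3) 1 => chorowidth u ^ 2) sphereUniform ∧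
    Integrable (fun u : Metric.sphere (0 : E3) 1 => periwidth u) sphereUniform ∧
    (∫ u : Metric.sphere (0 : E3) 1, chorowidth u ∂sphereUniform) = √3 / 2 ∧
    (∫ u : Metric.sphere (0 : E3) 1, chorowidth u ∂sphereUniform) = octahedronSurfaceArea / 4 ∧
    (∫ u : Metric.sphere (0 : E3) 1, chorowidth u ^ 2 ∂sphereUniform)
      = 1 / 2 + √2 / Real.pi - 1 / (2 * Real.pi) * arcsec 3 ∧
    (∫ u : Metric.sphere (0 : E3) 1, periwidth u ∂sphereUniform) = 3 * arcsec 3 ∧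
    -- distribution of the number of vertices of a random shadow
    sphereUniform.real {u | shadowVertexCount u = 4}
      = 3 / Real.pi * (Real.pi - 2 * arcsec 3) ∧
    sphereUniform.real {u | shadowVertexCount u = 6}
      = 2 / Real.pi * (3 * arcsec 3 - Real.pi) ∧
    -- piecewise formulas on the first hexadecant
    (∀ θ φ x y z : ℝ, 0 ≤ θ → θ ≤ Real.pi / 4 → 0 ≤ φ → φ ≤ Real.pi / 2 →
      x = Real.cos θ * Real.sin φ → y = Real.sin θ * Real.sin φ → z = Real.cos φ →
      -- the three regions cover the hexadecant
      ((deltaAngle ≤ φ ∧ max (alphaAngle φ) (betaAngle φ) ≤ θ) ∨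
        (Real.pi / 4 ≤ φ ∧ θ ≤ betaAngle φ) ∨
        (φ ≤ Real.pi / 4 ∧ θ ≤ alphaAngle φ)) ∧
      (deltaAngle ≤ φ → max (alphaAngle φ) (betaAngle φ) ≤ θ →
        chorowidth (sphericalPoint θ φ) = 1 / 2 * (x + y + z) ∧
        periwidth (sphericalPoint θ φ)
          = √2 * (√(2 - (x + y) ^ 2) + √(2 - (x + z) ^ 2) + √(2 - (y + z) ^ 2))) ∧
      (Real.pi / 4 ≤ φ → θ ≤ betaAngle φ →
        chorowidth (sphericalPoint θ φ) = x ∧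
        periwidth (sphericalPoint θ φ)
          = √2 * (√(2 - (y - z) ^ 2) + √(2 - (y + z) ^ 2))) ∧
      (φ ≤ Real.pi / 4 → θ ≤ alphaAngle φ →
        chorowidth (sphericalPoint θ φ) = z ∧
        periwidth (sphericalPoint θ φ)
          = √2 * (√(2 - (x - y) ^ 2) + √(2 - (x + y) ^ 2)))) := by
  refine ⟨integrable_of_continuous_sphere continuous_chorowidth_sphere,
    integrable_of_continuous_sphere (continuous_chorowidth_sphere.pow 2),
    integrable_integral_periwidth.1, integral_chorowidth, ?_, integral_chorowidth_sq,
    integrable_integral_periwidth.2, measureReal_shadowVertexCount.1,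
    measureReal_shadowVertexCount.2, ?_⟩
  · rw [integral_chorowidth, octahedronSurfaceArea_eq]
    ring
  · intro θ φ x y z h1 h2 h3 h4 hx hy hz
    exact shadow_on_hexadecant θ φ x y z h1 h2 h3 h4 hx hy hz
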